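/- **Setting.** For $x\in L_2(\mathbb R)$ (complex valued) let $X(i\omega)=\int e^{-i\omega t}x(t)\,dt$ be its Fourier transform. Let $\mathcal I_f$ be the set of Borel subsets of $\mathbb R$ of positive finite measure, $\mathcal I_\infty$ the set of Borel subsets of $\mathbb R$ that contain a half-line $(a,\infty)$ or $(-\infty,a)$, and $\mathcal I=\mathcal I_f\cup\mathcal I_\infty$. Let $m\ge 1$. A branching structure $\mathcal T=(\Gamma,I,h)$ consists of a set $\Gamma$ of pairs $(d,k)$ with $d,k\in\{1,\dots,m\}$, $d\ne k$, such that $(d,k)\in\Gamma$ implies $(k,d)\notin\Gamma$, and, for each $(d,k)\in\Gamma$, of a set $I_{d,k}\in\mathcal I$ and a continuous mapping $h_{d,k}:L_2(\mathbb R)\to L_2(\mathbb R)$. * $\mathcal L_{2,\mathcal T}$ is the set of all $\{x_d\}_{d=1}^m\in L_2(\mathbb R)^m$ such that $x_k=h_{d,k}(x_d)$ a.e. on $I_{d,k}$ for all $(d,k)\in\Gamma$ ($\mathcal T$-branched processes). * $\mathcal C_{\mathcal T}$ is the set of all $\{x_d\}\in\mathcal L_{2,\mathcal T}$ such that every $x_d$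 is continuous and $X_d(i\cdot)\in L_1(\mathbb R)$. * For $G=(G_1,\dots,G_m)$ with $G_d\in\mathcal I$, $\mathcal L^G_{2,\mathcal T}$ is the set of all $\{x_d\}\in\mathcal L_{2,\mathcal T}$ with $X_d(i\omega)=0$ for a.e. $\omega\in G_d$, $d=1,\dots,m$. * $j\rightharpoonup k$ means that $j\neq k$ and there is a directed chain in $\Gamma$ from $j$ to $k$; $A(M)=\{k:\ j\rightharpoonup k\text{ for some }j\in M\}$. Let $\Omega>0$ and $\tau\in(0,\pi/\Omega)$. **Hypotheses.** $I_{d,k}\in\mathcal I_\infty$ for all $(d,k)\in\Gamma$, and one of the following holds. (A) $h_{d,k}(x)=x$ for all $(d,k)\in\Gamma$, and the graph $\Gamma$, with directions disregarded, is connected. (B) $1\rightharpoonup d$ for all $d\ge2$, and there exist $n\in\{2,\dots,m\}$, mutually disjoint sets $M_1,\dots,M_n\subset\{2,\dots,m\}$, operators $\mathrm h_1,\dots,\mathrm h_n:L_2(\mathbb R)\to L_2(\mathbb R)$ and an open set $D\subset\mathbb R$ with $\operatorname{mes}(D\cap[-\Omega,\Omega])>0$ such that 1. $1\rightharpoonup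 d$ for all $d\in M_p$ and all $p$; 2. the sets $A(M_1),\dots,A(M_n)$ are mutually disjoint; 3. if $(d,k)\in\Gamma$ and $d\in A(M_p)$, then $k\in A(M_p)$; 4. if $(d,k)\in\Gamma$, then $k\in\bigcup_pM_p$ or $k\in\bigcup_pA(M_p)$; 5. $h_{d,k}(x)=x$ for all $(d,k)\in\Gamma$ such that $d\ne1$ or $k\notin\bigcup_pM_p$; 6. for every $p$, $h_{1,k}=\mathrm h_p$ for all $k\in M_p$ with $(1,k)\in\Gamma$, and there is $\mathrm H_p\in L_\infty$ with $\operatorname{ess\,sup}_{\omega\in D}|\mathrm H_p(i\omega)^{-1}|<\infty$ such that the Fourier transform of $\mathrm h_p(x)$ is $\mathrm H_p(i\omega)X(i\omega)$ for all $x\in L_2(\mathbb R)$; 7. closed loops of $\Gamma$ through the root do not impose contradictory transformations: if $(1,k)\in\Gamma$ and $k\in A(M_p)$, then $h_{1,k}=\mathrm h_p$, and if $1\in A(M_p)$, then $\mathrm h_p$ is the identity (this is automatic if $\Gamma$ is a tree with root $1$). **Theorem.** Let $\{x_d\}_{d=1}^m\in\mathcal C_{\mathcal T}$ be such that $X_1(i\omega)=0$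 for a.e. $\omega$ with $|\omega|>\Omega$. Then, for any $\varepsilon>0$, there exist $G=(G_1,\dots,G_m)$ with all $G_d\in\mathcal I$ and $G_1=\mathbb R\setminus[-\Omega,\Omega]$, and a process $\{\widehat x_d\}_{d=1}^m\in\mathcal L^G_{2,\mathcal T}\cap\mathcal C_{\mathcal T}$ such that $$\max_{d=1,\dots,m}\Bigl(\|x_d-\widehat x_d\|_{L_2(\mathbb R)}+\sup_{t\in\mathbb R}|x_d(t)-\widehat x_d(t)|\Bigr)\le\varepsilon$$ and the following holds. (i) $\{\widehat x_d\}$ is uniquely defined in $\mathcal L^G_{2,\mathcal T}$ by its samples $\{\widehat x_d(\tau k)\}_{k\in\mathbb Z,\ d=1,\dots,m}$: if $\{z_d\}\in\mathcal L^G_{2,\mathcal T}$ has continuous components and $z_d(\tau k)=\widehat x_d(\tau k)$ for all $k\in\mathbb Z$ and all $d$, then $z_d=\widehat x_d$ for all $d$. (ii) For any $s\in\mathbb Z$, $\{\widehat x_d\}$ is uniquely defined in $\mathcal L^G_{2,\mathcal T}$, up to equivalence, by the samples $\{\widehat x_1(\tau k)\}_{k\in\mathbb Z,\,k\le s}$ of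 its first branch alone: if $\{z_d\}\in\mathcal L^G_{2,\mathcal T}$ and the continuous version of $z_1$ satisfies $z_1(\tau k)=\widehat x_1(\tau k)$ for all $k\le s$, then $z_d=\widehat x_d$ in $L_2(\mathbb R)$ for all $d$. -/

import Mathlib

open MeasureTheory Set
open scoped FourierTransform ENNReal

noncomputable section

namespace Branching

/-- Complex-valued `L₂(ℝ)`. -/
abbrev L2 : Type := Lp ℂ 2 (volume : Measure ℝ)

/-- The Fourier transform `X(iω) = ∫ e^{-iωt} x(t) dt` of `x ∈ L₂(ℝ)`, in the angular frequency `ω`.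
Mathlib's transform on `L₂` uses the kernel `e^{-2πiξt}`, hence the substitution `ξ = ω / (2π)`. -/
def angularFourier (x : L2) (ω : ℝ) : ℂ := (𝓕 x : L2) (ω / (2 * Real.pi))

/-- Borel sets of positive finite measure. -/
def IsFin (B : Set ℝ) : Prop := MeasurableSet B ∧ 0 < volume B ∧ volume B < ∞

/-- Borel sets that contain a half-line. -/
def IsInf (B : Set ℝ) : Prop := MeasurableSet B ∧ ∃ a : ℝ, Ioi a ⊆ B ∨ Iio a ⊆ B

/-- The admissible sets. -/
def IsAdm (B : Set ℝ) : Prop := IsFin B ∨ IsInf B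

/-- A branching structure `(Γ, I, h)` on `m` branches. The branches are numbered from `0`, so
that the root branch has the number `0`. The values of `I` and `h` outside of `Γ` play no role. -/
structure BranchStructure (m : ℕ) where
  Γ : Set (Fin m × Fin m)
  I : Fin m → Fin m → Set ℝ
  h : Fin m → Fin m → L2 → L2
  ne_of_mem : ∀ d k, (d, k) ∈ Γ → d ≠ k
  asymm : ∀ d k, (d, k) ∈ Γ → (k, d) ∉ Γ
  I_adm : ∀ d k, (d, k) ∈ Γ → IsAdm (I d k)
  h_cont : ∀ d k, (d, k) ∈ Γ → Continuous (h d k)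

variable {m : ℕ}

/-- Membership in `L_{2,T}`: `x_k = h_{d,k}(x_d)` almost everywhere on `I_{d,k}`
for all `(d,k) ∈ Γ`. -/
def IsBranched (T : BranchStructure m) (x : Fin m → L2) : Prop :=
  ∀ d k, (d, k) ∈ T.Γ → ∀ᵐ t : ℝ, t ∈ T.I d k → (x k : ℝ → ℂ) t = (T.h d k (x d) : ℝ → ℂ) t

/-- `f` is the continuous version of the class `x ∈ L₂(ℝ)`. -/
def IsContRep (x : L2) (f : ℝ → ℂ) : Prop := Continuous f ∧ (x : ℝ → ℂ) =ᵐ[volume] f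

/-- Membership in `C_T`: a branched process all of whose components are continuous and have
an integrable Fourier transform. -/
def IsContBranched (T : BranchStructure m) (x : Fin m → L2) : Prop :=
  IsBranched T x ∧ ∀ d, (∃ f, IsContRep (x d) f) ∧ Integrable (angularFourier (x d)) volume

/-- `X(iω) = 0` for almost every `ω ∈ B`. -/
def SpectrumVanishesOn (x : L2) (B : Set ℝ) : Prop :=
  ∀ᵐ ω : ℝ, ω ∈ B → angularFourier x ω = 0

/-- Membership in `L^G_{2,T}`: branched processes with spectrum gaps `G_d`. -/
def IsBranchedWithGaps (T : BranchStructure m) (G : Fin m → Set ℝ) (x : Fin m → L2) : Prop :=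
  IsBranched T x ∧ ∀ d, SpectrumVanishesOn (x d) (G d)

/-- `j ⇀ k`: there is a directed chain in `Γ` from `j` to `k`, where `j ≠ k`. -/
def Reaches (T : BranchStructure m) (j k : Fin m) : Prop :=
  j ≠ k ∧ Relation.TransGen (fun a b => (a, b) ∈ T.Γ) j k

/-- `A(M)`, the set of branches that can be reached from a branch in `M`. -/
def descendants (T : BranchStructure m) (M : Set (Fin m)) : Set (Fin m) :=
  {k | ∃ j ∈ M, Reaches T j k}

/-- All transformations `h_{d,k}`, `(d,k) ∈ Γ`, are the identity. -/
def IdentityTransforms (T : BranchStructure m) : Prop :=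
  ∀ d k, (d, k) ∈ T.Γ → ∀ x, T.h d k x = x

/-- The graph `Γ`, with directions disregarded, is connected. -/
def GraphConnected (T : BranchStructure m) : Prop :=
  ∀ d k, Relation.ReflTransGen (fun a b => (a, b) ∈ T.Γ ∨ (b, a) ∈ T.Γ) d k

/-- The operator `F` acts in the frequency domain as the multiplication by a bounded function `H`
whose inverse is essentially bounded on `D`. The norms are inverted in `[0, ∞]`, where the
inverse of `0` is `∞`. -/
def IsMultiplier (D : Set ℝ) (F : L2 → L2) : Prop :=
  ∃ H : ℝ → ℂ, MemLp H ∞ volume ∧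
    essSup (fun ω => ‖H ω‖ₑ⁻¹) (volume.restrict D) < ∞ ∧
    ∀ x : L2, angularFourier (F x) =ᵐ[volume] fun ω => H ω * angularFourier x ω

/-- The structure decomposes into groups `M_p` of branches attached to the root, with the
transformation `F_p` in the frequency domain attached to the group `M_p`. -/
structure IsGrouped [NeZero m] (T : BranchStructure m) (D : Set ℝ) {n : ℕ}
    (M : Fin n → Set (Fin m)) (F : Fin n → L2 → L2) : Prop where
  two_le : 2 ≤ n
  le_m : n ≤ m
  isOpen_D : IsOpen D
  D_pos : 0 < volume D
  root_notMem : ∀ p, (0 : Fin m) ∉ M p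
  disjoint_M : ∀ p q, p ≠ q → Disjoint (M p) (M q)
  root_reaches : ∀ p, ∀ d ∈ M p, Reaches T 0 d
  disjoint_A : ∀ p q, p ≠ q → Disjoint (descendants T (M p)) (descendants T (M q))
  closed_A : ∀ d k, (d, k) ∈ T.Γ → ∀ p, d ∈ descendants T (M p) → k ∈ descendants T (M p)
  covers : ∀ d k, (d, k) ∈ T.Γ → (∃ p, k ∈ M p) ∨ ∃ p, k ∈ descendants T (M p)
  identity : ∀ d k, (d, k) ∈ T.Γ → (d ≠ 0 ∨ ∀ p, k ∉ M p) → ∀ x, T.h d k x = x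
  transform : ∀ p, ∀ k ∈ M p, (0, k) ∈ T.Γ → ∀ x, T.h 0 k x = F p x
  multiplier : ∀ p, IsMultiplier D (F p)
  /-- Closed loops of `Γ` through the root do not impose contradictory transformations
  (automatic if `Γ` is a tree with the given root): a branch that is reached both directly from
  the root and through the group `M_p` is obtained by the same transformation on both ways, and
  likewise for the root itself. -/
  loop_branch : ∀ p, ∀ k ∈ descendants T (M p), (0, k) ∈ T.Γ → ∀ x, T.h 0 k x = F p x
  loop_root : ∀ p, (0 : Fin m) ∈ descendants T (M p) → ∀ x, F p x = x

/-- The samples of `x` and `y` (of their continuous versions) at the times `τk`, `k ∈ S`,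
are the same. -/
def SameSamples (τ : ℝ) (S : Set ℤ) (x y : L2) : Prop :=
  ∃ f g : ℝ → ℂ, IsContRep x f ∧ IsContRep y g ∧ ∀ k ∈ S, f (τ * k) = g (τ * k)

end Branching

end

/-!
The proof has a construction part and a uniqueness part.

*Construction.* The processes are perturbed by one small function `u`, band-limited to `[-Ω, Ω]`:
`y_d = x_d - L_d u`, where `L_d` is the multiplier that carries the root to the branch `d` (the
identity for the root and in the case of identity transforms, `F_p` on the branches of the group
`p`). As the `L_d` are compatible with the transformations along all edges
(`IsGrouped.exists_multipliers`), the relations between the branches survive. Disjoint short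
intervals `G_d` are chosen in `D ∩ (-Ω, Ω)`, and the transform of `u` is `X_d / H_d` on `G_d` and
zero elsewhere; then `y_d` has the spectrum gap `G_d`, and `u` is small when the intervals are short
(`exists_correction`).

*Uniqueness.* Two facts of Hardy space type are needed: a function of `L₂(ℝ)` that vanishes on a
half-line and has a spectrum gap is zero (`eq_zero_of_halfLine_of_gap`), and so is a band-limited
function that vanishes at all points `τ k`, `k ≤ s`, of an oversampled grid
(`eq_zero_of_samples`). The second one determines the root branch by its samples, and the first one
transfers the equality along the edges of the graph.

Both facts are instances of one statement on the circle. Let `W` be integrable and `φ` circle-valued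
such that `W` vanishes where `φ` is close to some point `ζ`. If `∫ W φ^k = 0` for all large `k`,
then this holds for all `k ∈ ℤ` (`moments_eq_zero_of_gap`), and `W = 0` when `φ` is injective
(`ae_eq_zero_of_moments_eq_zero`). For the samples, `φ(ω) = e^{-iτω}`; for the half-line, `φ` is the
Cayley transform of the frequency line, and the vanishing moments express orthogonality to the
functions `t^k e^{-t}` on the half-line. The step from large `k` to all `k` uses a rational function
`q` with `q(0) = 1` that is smaller than `1` in modulus on the circle away from `ζ`: multiplication
by powers of `q(φ)` does not change `∫ W`, yet makes it tend to zero.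
-/

/-! ### Moments against circle-valued functions -/

/-- The functions whose moments of positive order against `ψ` vanish stay such when they are divided
by `1 - a ψ`: the moments `m_k` of the quotient satisfy `m_k = a m_{k+1}` and are bounded. -/
theorem moments_div_one_sub_mul {α : Type*} [TopologicalSpace α]
    [MeasurableSpace α] [OpensMeasurableSpace α] {μ : Measure α} {W : α → ℂ}
    {ψ : α → Circle} (hψ : Continuous ψ) (hW : Integrable W μ)
    (hm : ∀ k : ℕ, ∫ t, W t * (ψ t : ℂ) ^ (k + 1) ∂μ = 0) {a : ℝ} (ha : |a| < 1) :
    Integrable (fun t => W t * (1 - a * (ψ t : ℂ))⁻¹) μ ∧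
      ∀ k : ℕ, ∫ t, W t * (1 - a * (ψ t : ℂ))⁻¹ * (ψ t : ℂ) ^ (k + 1) ∂μ = 0 := by
  have hne : ∀ t, (1 - a * (ψ t : ℂ)) ≠ 0 := by
    intro t h
    have h1 : ‖(a : ℂ) * (ψ t : ℂ)‖ = 1 := by
      rw [← sub_eq_zero.1 h]; simp
    simp [Circle.norm_coe] at h1
    linarith
  have hlow : ∀ t, 1 - |a| ≤ ‖1 - a * (ψ t : ℂ)‖ := by
    intro t
    have := norm_sub_norm_le (1 : ℂ) (a * (ψ t : ℂ))
    simpa [Circle.norm_coe] using this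
  have hψm : Measurable fun t => (ψ t : ℂ) := by fun_prop
  have hV : Integrable (fun t => W t * (1 - a * (ψ t : ℂ))⁻¹) μ := by
    refine hW.mul_bdd (c := (1 - |a|)⁻¹) (by fun_prop) (.of_forall fun t => ?_)
    rw [norm_inv]
    exact inv_anti₀ (by linarith) (hlow t)
  refine ⟨hV, ?_⟩
  have hint : ∀ k : ℕ, Integrable (fun t => W t * (1 - a * (ψ t : ℂ))⁻¹ * (ψ t : ℂ) ^ k) μ :=
    fun k => hV.mul_bdd (c := 1) (by fun_prop) (.of_forall fun t => by simp [Circle.norm_coe])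
  set m : ℕ → ℂ := fun k => ∫ t, W t * (1 - a * (ψ t : ℂ))⁻¹ * (ψ t : ℂ) ^ (k + 1) ∂μ with hmdef
  have hrec : ∀ k, m k = a * m (k + 1) := by
    intro k
    rw [← sub_eq_zero, hmdef, ← integral_const_mul, ← integral_sub (hint _) ((hint _).const_mul _),
      ← hm k]
    refine integral_congr_ae (.of_forall fun t => ?_)
    have := hne t
    field_simp
    ring
  have hpow : ∀ k j, m k = (a : ℂ) ^ j * m (k + j) := by
    intro k j
    induction j with
    | zero => simp
    | succ j ih => rw [ih, hrec (k + j)]; ring_nf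
  have hbd : ∀ k, ‖m k‖ ≤ ∫ t, ‖W t * (1 - a * (ψ t : ℂ))⁻¹‖ ∂μ := by
    intro k
    refine (norm_integral_le_integral_norm _).trans (le_of_eq ?_)
    refine integral_congr_ae (.of_forall fun t => ?_)
    simp [Circle.norm_coe]
  intro k
  have hle : ∀ j : ℕ, ‖m k‖ ≤ |a| ^ j * ∫ t, ‖W t * (1 - a * (ψ t : ℂ))⁻¹‖ ∂μ := by
    intro j
    rw [hpow k j, norm_mul, norm_pow, Complex.norm_real, Real.norm_eq_abs]
    gcongr
    exact hbd _
  have hlim := (tendsto_pow_atTop_nhds_zero_of_lt_one (abs_nonneg a) ha).mul_const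
    (∫ t, ‖W t * (1 - a * (ψ t : ℂ))⁻¹‖ ∂μ)
  rw [zero_mul] at hlim
  exact norm_le_zero_iff.1 (ge_of_tendsto' hlim hle)

/-- If all moments of positive order of `W` against a circle-valued `ψ` vanish and `W` vanishes
where `ψ` is close to `1`, then the moment of order `0` vanishes as well. The function
`q(z) = (1 - b z) / (1 - a z)` satisfies `q(0) = 1`, so multiplication by `q(ψ)` changes no
integral, while `|q| < 1` on the remaining arc, so that `∫ W = ∫ W q(ψ)^n → 0`. -/
theorem integral_eq_zero_of_positive_moments_of_gap {α : Type*} [TopologicalSpace α]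
    [MeasurableSpace α] [OpensMeasurableSpace α] {μ : Measure α}
    {W : α → ℂ} {ψ : α → Circle} (hψ : Continuous ψ) (hW : Integrable W μ) {x₀ : ℝ} (hx₀ : x₀ < 1)
    (hgap : ∀ᵐ t ∂μ, x₀ < (ψ t : ℂ).re → W t = 0)
    (hm : ∀ k : ℕ, ∫ t, W t * (ψ t : ℂ) ^ (k + 1) ∂μ = 0) : ∫ t, W t ∂μ = 0 := by
  obtain ⟨c, hc0, hc1, hxc⟩ : ∃ c : ℝ, 0 ≤ c ∧ c < 1 ∧ x₀ ≤ c :=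
    ⟨max x₀ 0, le_max_right _ _, max_lt hx₀ one_pos, le_max_left _ _⟩
  -- On the circle, `|1 - b z| < |1 - a z|` for `b < a` means `2 Re z < a + b`; here `a + b = 1 + c`
  -- exceeds `2 c`.
  set a : ℝ := (2 + c) / 3 with hadef
  set b : ℝ := (1 + 2 * c) / 3 with hbdef
  have ha : |a| < 1 := by rw [abs_lt]; constructor <;> simp only [hadef] <;> linarith
  have hne : ∀ t, (1 - a * (ψ t : ℂ)) ≠ 0 := by
    intro t h
    have h1 : ‖(a : ℂ) * (ψ t : ℂ)‖ = 1 := by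
      rw [← sub_eq_zero.1 h]; simp
    simp [Circle.norm_coe] at h1
    linarith
  have hψm : Measurable fun t => (ψ t : ℂ) := by fun_prop
  set q : α → ℂ := fun t => (1 - b * (ψ t : ℂ)) * (1 - a * (ψ t : ℂ))⁻¹ with hq
  have hqlt : ∀ t, (ψ t : ℂ).re ≤ c → ‖q t‖ < 1 := by
    intro t ht
    have hn : ((ψ t : ℂ).re) ^ 2 + ((ψ t : ℂ).im) ^ 2 = 1 := by
      have := Circle.normSq_coe (ψ t)
      rw [Complex.normSq_apply] at this
      linarith
    have hsq : ∀ r : ℝ, ‖1 - r * (ψ t : ℂ)‖ ^ 2 = 1 - 2 * r * (ψ t : ℂ).re + r ^ 2 := by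
      intro r
      rw [← Complex.normSq_eq_norm_sq, Complex.normSq_apply]
      simp
      linear_combination r ^ 2 * hn
    have hpos : 0 < ‖1 - a * (ψ t : ℂ)‖ := norm_pos_iff.2 (hne t)
    rw [hq, norm_mul, norm_inv, ← div_eq_mul_inv, div_lt_one hpos]
    refine lt_of_pow_lt_pow_left₀ 2 hpos.le ?_
    rw [hsq, hsq]
    have h1 : 0 < a - b := by simp only [hadef, hbdef]; linarith
    have h2 : 0 < a + b - 2 * (ψ t : ℂ).re := by simp only [hadef, hbdef]; linarith
    nlinarith [mul_pos h1 h2]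
  have hqm : Measurable q := by fun_prop
  have key : ∀ n : ℕ, Integrable (fun t => W t * q t ^ n) μ ∧
      (∀ k : ℕ, ∫ t, W t * q t ^ n * (ψ t : ℂ) ^ (k + 1) ∂μ = 0) ∧
      ∫ t, W t * q t ^ n ∂μ = ∫ t, W t ∂μ := by
    intro n
    induction n with
    | zero => simpa using ⟨hW, hm⟩
    | succ n ih =>
      obtain ⟨hi, hk, he⟩ := ih
      obtain ⟨hVi, hVk⟩ := moments_div_one_sub_mul hψ hi hk ha
      set V : α → ℂ := fun t => W t * q t ^ n * (1 - a * (ψ t : ℂ))⁻¹ with hV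
      have hVint : ∀ k : ℕ, Integrable (fun t => V t * (ψ t : ℂ) ^ k) μ :=
        fun k => hVi.mul_bdd (c := 1) (by fun_prop) (.of_forall fun t => by simp [Circle.norm_coe])
      have hVint1 : Integrable (fun t => V t * (ψ t : ℂ)) μ := by simpa using hVint 1
      have hV1 : ∫ t, V t * (ψ t : ℂ) ∂μ = 0 := by simpa using hVk 0
      have hsplit : ∀ k : ℕ, (fun t => W t * q t ^ (n + 1) * (ψ t : ℂ) ^ k) =
          fun t => V t * (ψ t : ℂ) ^ k - b * (V t * (ψ t : ℂ) ^ (k + 1)) := by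
        intro k
        funext t
        simp only [hV, hq]
        ring
      have hsplit0 : (fun t => W t * q t ^ (n + 1)) = fun t => V t - b * (V t * (ψ t : ℂ)) := by
        simpa using hsplit 0
      have hback : (fun t => W t * q t ^ n) = fun t => V t - a * (V t * (ψ t : ℂ)) := by
        funext t
        have := hne t
        simp only [hV]
        field_simp
      refine ⟨?_, fun k => ?_, ?_⟩
      · rw [hsplit0]
        exact hVi.sub (hVint1.const_mul _)
      · rw [hsplit, integral_sub (hVint _) ((hVint _).const_mul _), integral_const_mul, hVk, hVk]
        simp
      · rw [← he, hsplit0, hback, integral_sub hVi (hVint1.const_mul _),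
          integral_sub hVi (hVint1.const_mul _), integral_const_mul, integral_const_mul, hV1]
        simp
  have hlim : Filter.Tendsto (fun n : ℕ => ∫ t, W t * q t ^ n ∂μ) Filter.atTop
      (nhds (∫ _, (0 : ℂ) ∂μ)) := by
    refine tendsto_integral_of_dominated_convergence (fun t => ‖W t‖)
      (fun n => (key n).1.aestronglyMeasurable) hW.norm (fun n => ?_) ?_
    · filter_upwards [hgap] with t ht
      by_cases hw : W t = 0
      · simp [hw]
      · have hre : (ψ t : ℂ).re ≤ c := by
          by_contra hcon
          exact hw (ht (by linarith))
        rw [norm_mul, norm_pow]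
        exact mul_le_of_le_one_right (norm_nonneg _)
          (pow_le_one₀ (norm_nonneg _) (hqlt t hre).le)
    · filter_upwards [hgap] with t ht
      by_cases hw : W t = 0
      · simp [hw]
      · have hre : (ψ t : ℂ).re ≤ c := by
          by_contra hcon
          exact hw (ht (by linarith))
        simpa using (tendsto_pow_atTop_nhds_zero_of_norm_lt_one (hqlt t hre)).const_mul (W t)
  simp only [(key _).2.2, integral_zero] at hlim
  exact tendsto_nhds_unique tendsto_const_nhds hlim

/-- If the moments of `W` against a circle-valued `φ` vanish from some order on, and `W` vanishes
where `φ` is close to the point `ζ` of the circle, then all moments vanish. -/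
theorem moments_eq_zero_of_gap {α : Type*} [TopologicalSpace α]
    [MeasurableSpace α] [OpensMeasurableSpace α] {μ : Measure α}
    {W : α → ℂ} {φ : α → Circle} (hφ : Continuous φ) (hW : Integrable W μ) (ζ : Circle) {x₀ : ℝ}
    (hx₀ : x₀ < 1) (hgap : ∀ᵐ t ∂μ, x₀ < ((ζ * φ t : Circle) : ℂ).re → W t = 0) {N : ℤ}
    (hm : ∀ k : ℤ, N ≤ k → ∫ t, W t * (φ t : ℂ) ^ k ∂μ = 0) (k : ℤ) :
    ∫ t, W t * (φ t : ℂ) ^ k ∂μ = 0 := by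
  have hφm : Measurable fun t => (φ t : ℂ) := by fun_prop
  have hne : ∀ t, (φ t : ℂ) ≠ 0 := fun t => (φ t).coe_ne_zero
  -- The moment of order `N - j` is obtained from those of higher order, applied to `W φ^(N - j)`.
  have down : ∀ j : ℕ, ∫ t, W t * (φ t : ℂ) ^ (N - j) ∂μ = 0 := by
    intro j
    induction j using Nat.strong_induction_on with
    | _ j ih =>
    have hint : Integrable (fun t => W t * (φ t : ℂ) ^ (N - j)) μ :=
      hW.mul_bdd (c := 1) (by
        have hc : Continuous fun t => (φ t : ℂ) := by fun_prop
        exact (hc.zpow₀ _ fun t => Or.inl (hne t)).measurable.aestronglyMeasurable)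
      (.of_forall fun t => by simp [Circle.norm_coe])
    refine integral_eq_zero_of_positive_moments_of_gap (ψ := fun t => ζ * φ t)
      (by fun_prop) hint hx₀ ?_ fun k => ?_
    · filter_upwards [hgap] with t ht h
      rw [ht h, zero_mul]
    · have hrw : ∀ t, W t * (φ t : ℂ) ^ (N - j) * ((ζ * φ t : Circle) : ℂ) ^ (k + 1) =
          (ζ : ℂ) ^ (k + 1) * (W t * (φ t : ℂ) ^ (N - j + (k + 1 : ℕ))) := by
        intro t
        rw [zpow_add₀ (hne t), zpow_natCast, Circle.coe_mul, mul_pow]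
        ring
      simp only [hrw, integral_const_mul]
      rcases le_or_gt j (k + 1) with h | h
      · rw [hm _ (by omega), mul_zero]
      · have := ih (j - (k + 1)) (by omega)
        rw [show N - ((j - (k + 1) : ℕ) : ℤ) = N - j + ((k + 1 : ℕ) : ℤ) by omega] at this
        rw [this, mul_zero]
  rcases le_total N k with h | h
  · exact hm k h
  · have := down (N - k).toNat
    rwa [show N - ((N - k).toNat : ℤ) = k by omega] at this

/-- An integrable function all of whose moments against a circle-valued `φ` vanish is orthogonal to
all continuous functions of `φ`, as the trigonometric polynomials are dense. -/
theorem integral_mul_comp_eq_zero {α : Type*} [TopologicalSpace α]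
    [MeasurableSpace α] [OpensMeasurableSpace α] {μ : Measure α}
    {W : α → ℂ} {φ : α → Circle} (hφ : Continuous φ) (hW : Integrable W μ)
    (hm : ∀ k : ℤ, ∫ t, W t * (φ t : ℂ) ^ k ∂μ = 0) (g : C(Circle, ℂ)) :
    ∫ t, W t * g (φ t) ∂μ = 0 := by
  have : Fact (0 < 2 * Real.pi) := ⟨by positivity⟩
  let e := AddCircle.homeomorphCircle'
  have he : Continuous fun t => e.symm (φ t) := e.symm.continuous.comp hφ
  have hint : ∀ f : C(AddCircle (2 * Real.pi), ℂ),
      Integrable (fun t => W t * f (e.symm (φ t))) μ := fun f =>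
    hW.mul_bdd (c := ‖f‖) (f.continuous.comp he).measurable.aestronglyMeasurable
      (.of_forall fun t => f.norm_coe_le_norm _)
  have hspan : ∀ f ∈ Submodule.span ℂ (range (@fourier (2 * Real.pi))),
      ∫ t, W t * f (e.symm (φ t)) ∂μ = 0 := by
    intro f hf
    induction hf using Submodule.span_induction with
    | mem f hf =>
      obtain ⟨n, rfl⟩ := hf
      rw [← hm n]
      refine integral_congr_ae (.of_forall fun t => ?_)
      have h1 : AddCircle.toCircle (e.symm (φ t)) = φ t := by
        have h2 : ∀ θ : AddCircle (2 * Real.pi), AddCircle.toCircle θ = e θ := by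
          intro θ
          induction θ using QuotientAddGroup.induction_on with
          | H y =>
            rw [AddCircle.toCircle_apply_mk, AddCircle.homeomorphCircle'_apply_mk]
            congr 1
            field_simp
        rw [h2, e.apply_symm_apply]
      simp only [fourier_apply, AddCircle.toCircle_zsmul, h1, Circle.coe_zpow]
    | zero => simp
    | add f g _ _ hf hg =>
      simp only [ContinuousMap.add_apply, mul_add]
      rw [integral_add (hint f) (hint g), hf, hg, add_zero]
    | smul c f _ hf =>
      simp only [ContinuousMap.smul_apply, smul_eq_mul, mul_left_comm _ c]
      rw [integral_const_mul, hf, mul_zero]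
  set G : C(AddCircle (2 * Real.pi), ℂ) := g.comp ⟨e, e.continuous⟩ with hG
  have hGg : ∀ t, g (φ t) = G (e.symm (φ t)) := by
    intro t
    simp [hG]
  simp only [hGg]
  have hmem : G ∈ (Submodule.span ℂ (range (@fourier (2 * Real.pi)))).topologicalClosure := by
    rw [span_fourier_closure_eq_top]; trivial
  have hcl : IsClosed {f : C(AddCircle (2 * Real.pi), ℂ) |
      ∫ t, W t * f (e.symm (φ t)) ∂μ = 0} := by
    refine isClosed_eq ?_ continuous_const
    refine continuous_iff_continuousAt.2 fun f => ?_
    refine tendsto_integral_filter_of_dominated_convergence (fun t => ‖W t‖ * (‖f‖ + 1))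
      (.of_forall fun h => (hint h).aestronglyMeasurable) ?_ (hW.norm.mul_const _)
      (.of_forall fun t => ?_)
    · have : ∀ᶠ h in nhds f, ‖h‖ < ‖f‖ + 1 :=
        continuous_norm.continuousAt.eventually (gt_mem_nhds (by linarith))
      filter_upwards [this] with h hh
      refine .of_forall fun t => ?_
      rw [norm_mul]
      gcongr
      exact (h.norm_coe_le_norm _).trans hh.le
    · exact ((ContinuousEvalConst.continuous_eval_const (e.symm (φ t))).tendsto f).const_mul _
  exact closure_minimal hspan hcl hmem

/-- An integrable function on `ℝ` that vanishes outside a closed set `E`, and all of whose moments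
against a continuous circle-valued function that is injective on `E` vanish, is zero. -/
theorem ae_eq_zero_of_moments_eq_zero {W : ℝ → ℂ} {φ : ℝ → Circle} (hφ : Continuous φ)
    (hW : Integrable W) {E : Set ℝ} (hE : IsClosed E) (hinj : InjOn φ E)
    (hWE : ∀ t, t ∉ E → W t = 0) (hm : ∀ k : ℤ, ∫ t, W t * (φ t : ℂ) ^ k = 0) :
    W =ᵐ[volume] 0 := by
  refine ae_eq_zero_of_forall_setIntegral_isCompact_eq_zero' hW.locallyIntegrable fun S hS => ?_
  have hK : IsCompact (φ '' (S ∩ E)) := (hS.inter_right hE).image hφ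
  set K := φ '' (S ∩ E) with hKdef
  -- The indicator function of a compact `S` is, on `E`, the limit of continuous functions of `φ`.
  let δ : ℕ → ℝ := fun n => 1 / ((n : ℝ) + 1)
  have hδ : ∀ n, 0 < δ n := fun n => by positivity
  let g : ℕ → C(Circle, ℂ) := fun n =>
    ⟨fun z => ((thickenedIndicator (hδ n) K z : ℝ) : ℂ), by fun_prop⟩
  have hlim : Filter.Tendsto (fun n => ∫ t, W t * g n (φ t)) Filter.atTop
      (nhds (∫ t in S, W t)) := by
    rw [← integral_indicator hS.measurableSet]
    refine tendsto_integral_of_dominated_convergence (fun t => ‖W t‖) (fun n => ?_) hW.norm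
      (fun n => .of_forall fun t => ?_) (.of_forall fun t => ?_)
    · exact hW.aestronglyMeasurable.mul ((g n).continuous.comp hφ).aestronglyMeasurable
    · have h1 : (thickenedIndicator (hδ n) K (φ t) : ℝ) ≤ 1 := by
        exact_mod_cast thickenedIndicator_le_one (hδ n) K (φ t)
      simp only [g, ContinuousMap.coe_mk, norm_mul, Complex.norm_real, NNReal.norm_eq]
      exact mul_le_of_le_one_right (norm_nonneg _) h1
    · by_cases ht : t ∈ E
      · have hlim0 := thickenedIndicator_tendsto_indicator_closure hδ
          (by simpa [δ] using tendsto_one_div_add_atTop_nhds_zero_nat (𝕜 := ℝ)) K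
        have h2 := (tendsto_pi_nhds.1 hlim0) (φ t)
        rw [hK.isClosed.closure_eq] at h2
        have h3 : Filter.Tendsto (fun n => W t * g n (φ t)) Filter.atTop
            (nhds (W t * (((K.indicator (fun _ => (1 : NNReal)) (φ t) : NNReal) : ℝ) : ℂ))) := by
          refine Filter.Tendsto.const_mul _ ?_
          exact ((Complex.continuous_ofReal.comp NNReal.continuous_coe).tendsto _).comp h2
        convert h3 using 2
        by_cases hS' : t ∈ S
        · have : φ t ∈ K := ⟨t, ⟨hS', ht⟩, rfl⟩
          simp [hS', this]
        · have : φ t ∉ K := by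
            rintro ⟨u, ⟨huS, huE⟩, hu⟩
            exact hS' (hinj huE ht hu ▸ huS)
          simp [hS', this]
      · simp [hWE t ht, indicator]
  simp only [integral_mul_comp_eq_zero hφ hW hm] at hlim
  exact tendsto_nhds_unique hlim tendsto_const_nhds

/-! ### The Fourier integral and the Fourier transform on `L₂` -/

namespace Branching

/-- On `L₁ ∩ L₂`, the Fourier transform of `L₂` is given by the Fourier integral: the two agree as
tempered distributions. -/
theorem fourier_ae_eq_fourierIntegral (x : L2) (hx : Integrable (x : ℝ → ℂ)) :
    (𝓕 x : L2) =ᵐ[volume] 𝓕 (x : ℝ → ℂ) := by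
  have hcont : Continuous (𝓕 (x : ℝ → ℂ)) :=
    VectorFourier.fourierIntegral_continuous Real.continuous_fourierChar
      (by exact continuous_inner) hx
  refine ae_eq_of_integral_contDiff_smul_eq
    ((Lp.memLp (𝓕 x : L2)).locallyIntegrable one_le_two) hcont.locallyIntegrable fun g hg hc => ?_
  have hg₁ : HasCompactSupport (Complex.ofRealCLM ∘ g) := hc.comp_left rfl
  have hg₂ : ContDiff ℝ ((⊤ : ℕ∞) : WithTop ℕ∞) (Complex.ofRealCLM ∘ g) := by fun_prop
  set G := hg₁.toSchwartzMap hg₂ with hG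
  have h1 : ∫ t, G t • (𝓕 x : L2) t = ∫ t, (𝓕 G) t • (x : ℝ → ℂ) t := by
    have h := congrArg (fun T => T G) (Lp.fourier_toTemperedDistribution_eq x)
    simpa [TemperedDistribution.fourier_apply] using h.symm
  have h2 : ∫ t, (𝓕 G) t • (x : ℝ → ℂ) t = ∫ t, G t • 𝓕 (x : ℝ → ℂ) t := by
    simpa [SchwartzMap.fourier_coe] using! VectorFourier.integral_fourierIntegral_smul_eq_flip
      (L := innerₗ ℝ) Real.continuous_fourierChar continuous_inner G.integrable hx
  calc _ = ∫ t, G t • (𝓕 x : L2) t := by simp [hG]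
    _ = ∫ t, G t • 𝓕 (x : ℝ → ℂ) t := h1.trans h2
    _ = _ := by simp [hG]

theorem continuous_fourierInvIntegral {f : ℝ → ℂ} (hf : Integrable f) : Continuous (𝓕⁻ f) := by
  have hcont : Continuous (𝓕 f) :=
    VectorFourier.fourierIntegral_continuous Real.continuous_fourierChar
      (by exact continuous_inner) hf
  have : 𝓕⁻ f = fun t => 𝓕 f (-t) := funext fun t => Real.fourierInv_eq_fourier_neg _ t
  rw [this]
  fun_prop

theorem fourierInv_ae_eq_fourierInvIntegral (x : L2) (hx : Integrable (x : ℝ → ℂ)) :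
    (𝓕⁻ x : L2) =ᵐ[volume] 𝓕⁻ (x : ℝ → ℂ) := by
  refine ae_eq_of_integral_contDiff_smul_eq
    ((Lp.memLp (𝓕⁻ x : L2)).locallyIntegrable one_le_two)
    (continuous_fourierInvIntegral hx).locallyIntegrable
    fun g hg hc => ?_
  have hg₁ : HasCompactSupport (Complex.ofRealCLM ∘ g) := hc.comp_left rfl
  have hg₂ : ContDiff ℝ ((⊤ : ℕ∞) : WithTop ℕ∞) (Complex.ofRealCLM ∘ g) := by fun_prop
  set G := hg₁.toSchwartzMap hg₂ with hG
  have h1 : ∫ t, G t • (𝓕⁻ x : L2) t = ∫ t, (𝓕⁻ G) t • (x : ℝ → ℂ) t := by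
    have h := congrArg (fun T => T G) (Lp.fourierInv_toTemperedDistribution_eq x)
    simpa [TemperedDistribution.fourierInv_apply] using h.symm
  have h2 : ∫ t, (𝓕⁻ G) t • (x : ℝ → ℂ) t = ∫ t, G t • 𝓕⁻ (x : ℝ → ℂ) t := by
    have hL : Continuous fun p : ℝ × ℝ => (-innerₗ ℝ : ℝ →ₗ[ℝ] ℝ →ₗ[ℝ] ℝ) p.1 p.2 := by
      simp only [LinearMap.neg_apply, innerₗ_apply_apply]
      fun_prop
    have h := VectorFourier.integral_fourierIntegral_smul_eq_flip
      (L := -innerₗ ℝ) Real.continuous_fourierChar hL (G.integrable (μ := volume)) hx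
    have h3 : ∀ (f : ℝ → ℂ) (t : ℝ), 𝓕⁻ f t =
        VectorFourier.fourierIntegral Real.fourierChar volume (-innerₗ ℝ) f t := by
      intro f t
      rw [Real.fourierInv_eq, VectorFourier.fourierIntegral]
      simp
    have h4 : (-innerₗ ℝ : ℝ →ₗ[ℝ] ℝ →ₗ[ℝ] ℝ).flip = -innerₗ ℝ := by
      ext; simp
    rw [h4] at h
    simp only [SchwartzMap.fourierInv_coe, h3]
    exact h
  calc _ = ∫ t, G t • (𝓕⁻ x : L2) t := by simp [hG]
    _ = ∫ t, G t • 𝓕⁻ (x : ℝ → ℂ) t := h1.trans h2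
    _ = _ := by simp [hG]

end Branching

/-! ### Gamma densities and their transforms -/

theorem integrableOn_pow_mul_exp_neg (k : ℕ) :
    IntegrableOn (fun u : ℝ => u ^ k * Real.exp (-u)) (Ioi 0) := by
  have h := Real.GammaIntegral_convergent (s := k + 1) (by positivity)
  refine h.congr_fun (fun u hu => ?_) measurableSet_Ioi
  simp [mul_comm]

theorem norm_pow_mul_cexp_neg (k : ℕ) {z : ℂ} (hz : z.re = 1) {u : ℝ} (hu : 0 ≤ u) :
    ‖(u : ℂ) ^ k * Complex.exp (-(z * u))‖ = u ^ k * Real.exp (-u) := by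
  rw [norm_mul, norm_pow, Complex.norm_real, Real.norm_of_nonneg hu, Complex.norm_exp]
  simp [hz]

/-- The Laplace transform of `u ^ k` on the line `Re z = 1`. -/
theorem integral_pow_mul_cexp_neg (k : ℕ) {z : ℂ} (hz : z.re = 1) :
    ∫ u : ℝ in Ioi 0, (u : ℂ) ^ k * Complex.exp (-(z * u)) = k.factorial / z ^ (k + 1) := by
  have hz0 : z ≠ 0 := by rintro rfl; simp at hz
  have hint : ∀ k : ℕ,
      IntegrableOn (fun u : ℝ => (u : ℂ) ^ k * Complex.exp (-(z * u))) (Ioi 0) := by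
    intro k
    refine (integrableOn_pow_mul_exp_neg k).mono' (by fun_prop) ?_
    filter_upwards [ae_restrict_mem measurableSet_Ioi] with u hu
    exact (norm_pow_mul_cexp_neg k hz (le_of_lt hu)).le
  have hlim : ∀ k : ℕ, Filter.Tendsto (fun u : ℝ => (u : ℂ) ^ k * Complex.exp (-(z * u)))
      Filter.atTop (nhds 0) := by
    intro k
    rw [tendsto_zero_iff_norm_tendsto_zero]
    refine (Real.tendsto_pow_mul_exp_neg_atTop_nhds_zero k).congr' ?_
    filter_upwards [Filter.eventually_ge_atTop 0] with u hu
    exact (norm_pow_mul_cexp_neg k hz hu).symm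
  have hexp : ∀ u : ℝ, HasDerivAt (fun u : ℝ => Complex.exp (-(z * u)))
      (Complex.exp (-(z * u)) * (-z)) u := by
    intro u
    have := ((Complex.ofRealCLM.hasDerivAt (x := u)).const_mul z).neg.cexp
    simpa using this
  have hpow : ∀ (k : ℕ) (u : ℝ), HasDerivAt (fun u : ℝ => (u : ℂ) ^ (k + 1))
      ((k + 1 : ℂ) * (u : ℂ) ^ k) u := by
    intro k u
    have := (Complex.ofRealCLM.hasDerivAt (x := u)).fun_pow (k + 1)
    simpa using this
  induction k with
  | zero =>
    have h := integral_Ioi_of_hasDerivAt_of_tendsto (a := 0)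
      (f := fun u : ℝ => Complex.exp (-(z * u)))
      (f' := fun u : ℝ => (-z) * ((u : ℂ) ^ 0 * Complex.exp (-(z * u))))
      (by fun_prop) (fun u _ => by simpa [mul_comm] using hexp u)
      ((hint 0).const_mul _) (by simpa using hlim 0)
    rw [integral_const_mul] at h
    have h1 : z * ∫ u : ℝ in Ioi 0, (u : ℂ) ^ 0 * Complex.exp (-(z * u)) = 1 := by
      simp only [Complex.ofReal_zero, mul_zero, neg_zero, Complex.exp_zero, zero_sub] at h
      linear_combination -h
    rw [zero_add, pow_one, eq_div_iff hz0, mul_comm, h1]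
    simp
  | succ k ih =>
    have h := integral_Ioi_of_hasDerivAt_of_tendsto (a := 0)
      (f := fun u : ℝ => (u : ℂ) ^ (k + 1) * Complex.exp (-(z * u)))
      (f' := fun u : ℝ => (k + 1 : ℂ) * ((u : ℂ) ^ k * Complex.exp (-(z * u))) -
        z * ((u : ℂ) ^ (k + 1) * Complex.exp (-(z * u))))
      (by fun_prop) (fun u _ => by
        refine ((hpow k u).mul (hexp u)).congr_deriv ?_
        ring)
      (((hint k).const_mul _).sub ((hint (k + 1)).const_mul _)) (hlim (k + 1))
    rw [integral_sub ((hint k).const_mul _) ((hint (k + 1)).const_mul _), integral_const_mul,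
      integral_const_mul, ih] at h
    simp only [Complex.ofReal_zero, ne_eq, Nat.add_eq_zero_iff, one_ne_zero, and_false,
      not_false_eq_true, zero_pow, zero_mul, sub_zero] at h
    rw [sub_eq_zero] at h
    rw [pow_succ z (k + 1), eq_div_iff (mul_ne_zero (pow_ne_zero _ hz0) hz0), Nat.factorial_succ]
    push_cast
    field_simp at h
    linear_combination -h

namespace Branching

theorem quasiMeasurePreserving_mul_left {c : ℝ} (hc : c ≠ 0) :
    Measure.QuasiMeasurePreserving (fun t : ℝ => c * t) volume volume := by
  refine ⟨by fun_prop, ?_⟩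
  rw [Real.map_volume_mul_left hc]
  exact Measure.smul_absolutelyContinuous

theorem quasiMeasurePreserving_div_two_pi :
    Measure.QuasiMeasurePreserving (fun ω : ℝ => ω / (2 * Real.pi)) volume volume := by
  simpa only [div_eq_inv_mul] using
    quasiMeasurePreserving_mul_left (inv_ne_zero Real.two_pi_pos.ne')

theorem angularFourier_two_pi_mul (x : L2) (ξ : ℝ) :
    angularFourier x (2 * Real.pi * ξ) = (𝓕 x : L2) ξ := by
  rw [angularFourier, mul_div_cancel_left₀ _ Real.two_pi_pos.ne']

/-- The function `t ↦ u^k e^{-u}` for `u = σ (t - a) > 0`, and zero elsewhere: an unnormalized gamma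
density, shifted by `a` and, for `σ = -1`, reflected. -/
noncomputable def gammaPulse (σ a : ℝ) (k : ℕ) (t : ℝ) : ℂ :=
  (Ioi (0 : ℝ)).indicator (fun u : ℝ => (u : ℂ) ^ k * Complex.exp (-u)) (σ * (t - a))

theorem integrable_gammaKernel (k : ℕ) :
    Integrable ((Ioi (0 : ℝ)).indicator fun u : ℝ => (u : ℂ) ^ k * Complex.exp (-u)) := by
  refine IntegrableOn.integrable_indicator ?_ measurableSet_Ioi
  refine (integrableOn_pow_mul_exp_neg k).mono' (by fun_prop) ?_
  filter_upwards [ae_restrict_mem measurableSet_Ioi] with u hu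
  simpa using (norm_pow_mul_cexp_neg k Complex.one_re (le_of_lt hu)).le

theorem integral_comp_affine {E : Type*} [NormedAddCommGroup E] [NormedSpace ℝ E] {σ : ℝ}
    (hσ : σ = 1 ∨ σ = -1) (a : ℝ) (f : ℝ → E) : ∫ t, f (σ * (t - a)) = ∫ u, f u := by
  rw [integral_sub_right_eq_self (fun t => f (σ * t)) a, Measure.integral_comp_mul_left]
  rcases hσ with rfl | rfl <;> simp

theorem integrable_comp_affine {E : Type*} [NormedAddCommGroup E] {σ : ℝ}
    (hσ : σ ≠ 0) (a : ℝ) {f : ℝ → E} (hf : Integrable f) :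
    Integrable fun t => f (σ * (t - a)) :=
  (hf.comp_mul_left' hσ).comp_sub_right a

theorem integrable_gammaPulse {σ : ℝ} (hσ : σ ≠ 0) (a : ℝ) (k : ℕ) :
    Integrable (gammaPulse σ a k) :=
  integrable_comp_affine hσ a (integrable_gammaKernel k)

theorem memLp_gammaPulse {σ : ℝ} (hσ : σ ≠ 0) (a : ℝ) (k : ℕ) :
    MemLp (gammaPulse σ a k) 2 := by
  rw [memLp_two_iff_integrable_sq_norm (integrable_gammaPulse hσ a k).aestronglyMeasurable]
  refine (integrable_gammaPulse hσ a (2 * k)).norm.mono'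
    ((integrable_gammaPulse hσ a k).aestronglyMeasurable.norm.pow 2) (.of_forall fun t => ?_)
  simp only [gammaPulse, indicator_apply, mem_Ioi]
  split_ifs with h
  · have h1 := norm_pow_mul_cexp_neg k Complex.one_re h.le
    have h2 := norm_pow_mul_cexp_neg (2 * k) Complex.one_re h.le
    simp only [one_mul] at h1 h2
    rw [h1, h2, Real.norm_of_nonneg (by positivity), mul_pow, ← pow_mul, mul_comm k 2,
      sq (Real.exp _), ← mul_assoc]
    refine mul_le_of_le_one_right (by positivity) (Real.exp_le_one_iff.2 (by linarith))
  · simp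

theorem fourier_gammaPulse {σ : ℝ} (hσ : σ = 1 ∨ σ = -1) (a : ℝ) (k : ℕ) (ξ : ℝ) :
    𝓕 (gammaPulse σ a k) ξ = Complex.exp (-(2 * Real.pi * a * ξ * Complex.I)) *
      (k.factorial / (1 + 2 * Real.pi * σ * ξ * Complex.I) ^ (k + 1)) := by
  have hσ2 : (σ : ℂ) * σ = 1 := by
    rcases hσ with rfl | rfl <;> simp
  rw [Real.fourier_real_eq_integral_exp_smul,
    ← integral_pow_mul_cexp_neg k (z := 1 + 2 * Real.pi * σ * ξ * Complex.I) (by simp),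
    ← integral_const_mul, ← integral_indicator measurableSet_Ioi]
  conv_rhs => rw [← integral_comp_affine hσ a]
  refine integral_congr_ae (.of_forall fun t => ?_)
  simp only [gammaPulse, indicator_apply, mem_Ioi, smul_eq_mul, mul_ite, mul_zero]
  split_ifs with h
  · rw [mul_left_comm, mul_left_comm _ (_ ^ k), ← Complex.exp_add, ← Complex.exp_add]
    congr 2
    push_cast
    linear_combination (2 * Real.pi * ξ * Complex.I * (t - a)) * hσ2
  · rfl

end Branching

/-! ### The Cayley transform of the frequency line -/

theorem Circle.re_inv_mul (u v : Circle) :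
    ((u⁻¹ * v : Circle) : ℂ).re = 1 - ‖(v : ℂ) - u‖ ^ 2 / 2 := by
  have hu := Circle.normSq_coe u
  have hv := Circle.normSq_coe v
  rw [Complex.normSq_apply] at hu hv
  rw [← Complex.normSq_eq_norm_sq, Complex.normSq_apply, Circle.coe_mul,
    Circle.coe_inv_eq_conj]
  simp
  linear_combination (hu + hv) / 2

/-- The Cayley transform `ξ ↦ (1 + iκξ) / (1 - iκξ)` of the line onto the circle without `-1`. -/
noncomputable def cayleyCircle (κ ξ : ℝ) : Circle :=
  Circle.ofConjDivSelf (1 - κ * ξ * Complex.I) (by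
    intro h
    simpa using congrArg Complex.re h)

theorem one_sub_mul_I_ne_zero (κ ξ : ℝ) : (1 - κ * ξ * Complex.I : ℂ) ≠ 0 := by
  intro h
  simpa using congrArg Complex.re h

theorem coe_cayleyCircle (κ ξ : ℝ) :
    (cayleyCircle κ ξ : ℂ) = 2 * (1 - κ * ξ * Complex.I)⁻¹ - 1 := by
  have := one_sub_mul_I_ne_zero κ ξ
  simp only [cayleyCircle, Circle.ofConjDivSelf_coe, map_sub, map_one, map_mul, Complex.conj_ofReal,
    Complex.conj_I]
  field_simp
  ring

theorem continuous_cayleyCircle (κ : ℝ) : Continuous (cayleyCircle κ) := by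
  refine continuous_induced_rng.2 ?_
  have h : ((↑) ∘ cayleyCircle κ : ℝ → ℂ) = fun ξ : ℝ => 2 * (1 - κ * ξ * Complex.I : ℂ)⁻¹ - 1 :=
    funext (coe_cayleyCircle κ)
  change Continuous ((↑) ∘ cayleyCircle κ : ℝ → ℂ)
  rw [h]
  exact ((Continuous.inv₀ (by fun_prop) (one_sub_mul_I_ne_zero κ)).const_mul 2).sub
    continuous_const

theorem injective_cayleyCircle {κ : ℝ} (hκ : κ ≠ 0) : Function.Injective (cayleyCircle κ) := by
  intro ξ η h
  have h1 := congrArg (fun z : Circle => (z : ℂ)) h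
  simp only [coe_cayleyCircle] at h1
  have h2 : (1 - κ * ξ * Complex.I : ℂ) = 1 - κ * η * Complex.I :=
    inv_injective (mul_left_cancel₀ two_ne_zero (sub_left_injective h1))
  have h3 := congrArg Complex.im h2
  simpa [hκ] using h3

/-- Points of the line at distance at least `δ` from `ξ₀` stay away from the image of `ξ₀`
on the circle. -/
theorem exists_re_cayleyCircle_le {κ : ℝ} (hκ : κ ≠ 0) (ξ₀ : ℝ) {δ : ℝ} (hδ : 0 < δ) :
    ∃ x₀ < 1, ∀ ξ, x₀ < (((cayleyCircle κ ξ₀)⁻¹ * cayleyCircle κ ξ : Circle) : ℂ).re →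
      |ξ - ξ₀| < δ := by
  set z₀ : ℂ := 1 - κ * ξ₀ * Complex.I with hz₀
  have hz₀p : 0 < ‖z₀‖ := norm_pos_iff.2 (one_sub_mul_I_ne_zero κ ξ₀)
  have hκp : 0 < |κ| := abs_pos.2 hκ
  set r : ℝ := 2 * |κ| / (‖z₀‖ * (‖z₀‖ / δ + |κ|)) with hr
  have hrp : 0 < r := by positivity
  refine ⟨1 - r ^ 2 / 2, by nlinarith [sq_pos_of_pos hrp], fun ξ h => ?_⟩
  rw [Circle.re_inv_mul] at h
  have hlt : ‖(cayleyCircle κ ξ : ℂ) - cayleyCircle κ ξ₀‖ < r :=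
    lt_of_pow_lt_pow_left₀ 2 hrp.le (by linarith)
  by_contra! hcon
  set z : ℂ := 1 - κ * ξ * Complex.I with hz
  have hzp : 0 < ‖z‖ := norm_pos_iff.2 (one_sub_mul_I_ne_zero κ ξ)
  have hdiff : ‖z₀ - z‖ = |κ| * |ξ - ξ₀| := by
    have : z₀ - z = ((κ * (ξ - ξ₀) : ℝ) : ℂ) * Complex.I := by
      rw [hz₀, hz]; push_cast; ring
    rw [this, norm_mul, Complex.norm_I, mul_one, Complex.norm_real, Real.norm_eq_abs, abs_mul]
  have hform : ‖(cayleyCircle κ ξ : ℂ) - cayleyCircle κ ξ₀‖ =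
      2 * (|κ| * |ξ - ξ₀|) / (‖z‖ * ‖z₀‖) := by
    have : (cayleyCircle κ ξ : ℂ) - cayleyCircle κ ξ₀ = 2 * (z₀ - z) / (z * z₀) := by
      rw [coe_cayleyCircle, coe_cayleyCircle, ← hz, ← hz₀]
      have h1 : z ≠ 0 := norm_pos_iff.1 hzp
      have h2 : z₀ ≠ 0 := norm_pos_iff.1 hz₀p
      field_simp
      ring
    rw [this, norm_div, norm_mul, norm_mul, hdiff]
    simp
  have hzle : ‖z‖ ≤ |ξ - ξ₀| * (‖z₀‖ / δ + |κ|) := by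
    have h1 : ‖z‖ ≤ ‖z₀‖ + ‖z₀ - z‖ := by
      have := norm_sub_le z₀ (z₀ - z)
      simpa using this
    have h2 : ‖z₀‖ ≤ |ξ - ξ₀| * (‖z₀‖ / δ) := by
      rw [mul_div_assoc', le_div_iff₀ hδ, mul_comm |ξ - ξ₀|]
      gcongr
    rw [hdiff] at h1
    linarith [mul_comm |κ| |ξ - ξ₀|, mul_add |ξ - ξ₀| (‖z₀‖ / δ) |κ|]
  rw [hform, hr, div_lt_div_iff₀ (by positivity) (by positivity)] at hlt
  have : 2 * |κ| * (‖z‖ * ‖z₀‖) ≤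
      2 * |κ| * ((|ξ - ξ₀| * (‖z₀‖ / δ + |κ|)) * ‖z₀‖) := by gcongr
  linarith

/-! ### Functions vanishing on a half-line -/

namespace Branching

/-- A function of `L₂` that vanishes on a half-line and whose spectrum has a gap is zero. The half
line is `{t | 0 < σ (t - a)}` with `σ = ±1`. In the frequency domain the vanishing on the half-line
says that the moments of nonnegative order of `X(ξ) e^{2πiaξ} / (1 - 2πiσξ)` against the Cayley
transform of the line vanish. -/
theorem eq_zero_of_halfLine_of_gap (x : L2) {σ : ℝ} (hσ : σ = 1 ∨ σ = -1) (a : ℝ)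
    (hx : ∀ᵐ t : ℝ, 0 < σ * (t - a) → (x : ℝ → ℂ) t = 0) {c d : ℝ} (hcd : c < d)
    (hgap : SpectrumVanishesOn x (Ioo c d)) : x = 0 := by
  have hσ0 : σ ≠ 0 := by rcases hσ with rfl | rfl <;> norm_num
  set κ : ℝ := 2 * Real.pi * σ with hκdef
  have hκ : κ ≠ 0 := mul_ne_zero Real.two_pi_pos.ne' hσ0
  set X : L2 := 𝓕 x with hX
  let e : ℕ → L2 := fun k => (memLp_gammaPulse hσ0 a k).toLp _
  have heF : ∀ k, ((𝓕 (e k) : L2) : ℝ → ℂ) =ᵐ[volume]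
      fun ξ => Complex.exp (-(2 * Real.pi * a * ξ * Complex.I)) *
      (k.factorial / (1 + 2 * Real.pi * σ * ξ * Complex.I) ^ (k + 1)) := by
    intro k
    have hcoe := (memLp_gammaPulse hσ0 a k).coeFn_toLp
    have h1 := fourier_ae_eq_fourierIntegral (e k)
      ((integrable_congr hcoe).2 (integrable_gammaPulse hσ0 a k))
    refine h1.trans (.of_forall fun ξ => ?_)
    rw [Real.fourier_congr_ae hcoe, fourier_gammaPulse hσ]
  set W : ℝ → ℂ := fun ξ => X ξ * Complex.exp (2 * Real.pi * a * ξ * Complex.I) *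
    (1 - κ * ξ * Complex.I)⁻¹ with hW
  have hinner : ∀ k : ℕ, (fun ξ => inner ℂ ((𝓕 (e k) : L2) ξ) (X ξ)) =ᵐ[volume]
      fun ξ => k.factorial * (W ξ * ((1 - κ * ξ * Complex.I)⁻¹) ^ k) := by
    intro k
    filter_upwards [heF k] with ξ hξ
    rw [hξ]
    simp only [RCLike.inner_apply, map_mul, map_div₀, map_pow, map_add, map_one, map_natCast,
      Complex.conj_ofReal, Complex.conj_I, ← Complex.exp_conj, map_neg, map_ofNat, hW, hκdef]
    push_cast
    simp only [div_eq_mul_inv, pow_succ, mul_inv, inv_pow, mul_neg, neg_neg, ← sub_eq_add_neg]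
    ring
  have hWint : Integrable W := by
    have := (L2.integrable_inner (𝕜 := ℂ) (𝓕 (e 0) : L2) X).congr (hinner 0)
    simpa using this
  have hbase : ∀ k : ℕ, ∫ ξ, W ξ * ((1 - κ * ξ * Complex.I)⁻¹) ^ k = 0 := by
    intro k
    have h1 : inner ℂ (𝓕 (e k) : L2) X = 0 := by
      rw [hX, Lp.inner_fourier_eq, L2.inner_def]
      refine integral_eq_zero_of_ae ?_
      filter_upwards [(memLp_gammaPulse hσ0 a k).coeFn_toLp, hx] with t ht hxt
      rw [ht]
      by_cases h : 0 < σ * (t - a)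
      · simp [hxt h]
      · simp [gammaPulse, h]
    rw [L2.inner_def, integral_congr_ae (hinner k), integral_const_mul] at h1
    exact (mul_eq_zero.1 h1).resolve_left (by exact_mod_cast k.factorial_ne_zero)
  have hinvle : ∀ ξ : ℝ, ‖(1 - κ * ξ * Complex.I : ℂ)⁻¹‖ ≤ 1 := by
    intro ξ
    rw [norm_inv]
    refine inv_le_one_of_one_le₀ ?_
    have := Complex.abs_re_le_norm (1 - κ * ξ * Complex.I)
    simpa using this
  have hmeas : Continuous fun ξ : ℝ => (1 - κ * ξ * Complex.I : ℂ)⁻¹ :=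
    Continuous.inv₀ (by fun_prop) (one_sub_mul_I_ne_zero κ)
  have hφ := continuous_cayleyCircle κ
  have hint : ∀ j k : ℕ, Integrable fun ξ : ℝ =>
      W ξ * (((1 - κ * ξ * Complex.I)⁻¹) ^ j * (cayleyCircle κ ξ : ℂ) ^ k) := by
    intro j k
    refine hWint.mul_bdd (c := 1) ?_ (.of_forall fun ξ => ?_)
    · exact ((hmeas.pow j).mul
        ((continuous_induced_dom.comp hφ : Continuous fun ξ => (cayleyCircle κ ξ : ℂ)).pow k)
        ).aestronglyMeasurable
    · rw [norm_mul, norm_pow, norm_pow, Circle.norm_coe, one_pow, mul_one]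
      exact pow_le_one₀ (norm_nonneg _) (hinvle ξ)
  -- The Cayley transform is `2 / (1 - iκξ) - 1`, so its powers are combinations of those of
  -- `1 / (1 - iκξ)`.
  have hmom : ∀ k j : ℕ, ∫ ξ : ℝ,
      W ξ * (((1 - κ * ξ * Complex.I)⁻¹) ^ j * (cayleyCircle κ ξ : ℂ) ^ k) = 0 := by
    intro k
    induction k with
    | zero => intro j; simpa using hbase j
    | succ k ih =>
      intro j
      have hsplit : ∀ ξ : ℝ,
          W ξ * (((1 - κ * ξ * Complex.I)⁻¹) ^ j * (cayleyCircle κ ξ : ℂ) ^ (k + 1)) =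
          2 * (W ξ * (((1 - κ * ξ * Complex.I)⁻¹) ^ (j + 1) * (cayleyCircle κ ξ : ℂ) ^ k)) -
          W ξ * (((1 - κ * ξ * Complex.I)⁻¹) ^ j * (cayleyCircle κ ξ : ℂ) ^ k) := by
        intro ξ
        rw [pow_succ (cayleyCircle κ ξ : ℂ)]
        nth_rewrite 2 [coe_cayleyCircle]
        ring
      simp only [hsplit]
      rw [integral_sub ((hint _ _).const_mul _) (hint _ _), integral_const_mul, ih, ih]
      simp
  have hXgap : ∀ᵐ ξ : ℝ, 2 * Real.pi * ξ ∈ Ioo c d → X ξ = 0 := by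
    filter_upwards [(quasiMeasurePreserving_mul_left Real.two_pi_pos.ne').ae hgap] with ξ h hξ
    rw [← angularFourier_two_pi_mul x ξ]
    exact h hξ
  set ξ₀ : ℝ := (c + d) / (4 * Real.pi) with hξ₀
  obtain ⟨x₀, hx₀, hnear⟩ := exists_re_cayleyCircle_le hκ ξ₀
    (δ := (d - c) / (4 * Real.pi)) (by have := Real.pi_pos; have := sub_pos.2 hcd; positivity)
  have hall := moments_eq_zero_of_gap hφ hWint (cayleyCircle κ ξ₀)⁻¹ hx₀ (N := 0)
    (by
      filter_upwards [hXgap] with ξ hξ hre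
      have h1 := hnear ξ hre
      have hpi := Real.pi_pos
      rw [abs_lt, hξ₀, ← neg_div, lt_sub_iff_add_lt, ← add_div, sub_lt_iff_lt_add, ← add_div,
        div_lt_iff₀ (by positivity), lt_div_iff₀ (by positivity)] at h1
      have h2 : X ξ = 0 := hξ ⟨by linarith, by linarith⟩
      simp [hW, h2])
    (by
      intro k hk
      obtain ⟨n, rfl⟩ := Int.eq_ofNat_of_zero_le hk
      simpa using hmom n 0)
  have hW0 := ae_eq_zero_of_moments_eq_zero hφ hWint isClosed_univ
    (injective_cayleyCircle hκ).injOn (by simp) hall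
  have hX0 : X = 0 := by
    refine (Lp.eq_zero_iff_ae_eq_zero).2 ?_
    filter_upwards [hW0] with ξ hξ
    have h1 := one_sub_mul_I_ne_zero κ ξ
    simpa [hW, h1, Complex.exp_ne_zero] using hξ
  have : ‖x‖ = 0 := by rw [← Lp.norm_fourier_eq, ← hX, hX0, norm_zero]
  exact norm_eq_zero.1 this

end Branching

/-! ### Angular frequency and samples of band-limited functions -/

namespace Branching

theorem memLp_angularFourier (x : L2) : MemLp (angularFourier x) 2 := by
  have hmeas : AEStronglyMeasurable (angularFourier x) volume :=
    (Lp.aestronglyMeasurable (𝓕 x : L2)).comp_quasiMeasurePreserving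
      quasiMeasurePreserving_div_two_pi
  rw [memLp_two_iff_integrable_sq_norm hmeas]
  have h := (memLp_two_iff_integrable_sq_norm (Lp.aestronglyMeasurable (𝓕 x : L2))).1
    (Lp.memLp (𝓕 x : L2))
  exact h.comp_div Real.two_pi_pos.ne'

theorem angularFourier_sub (x y : L2) :
    angularFourier (x - y) =ᵐ[volume] fun ω => angularFourier x ω - angularFourier y ω := by
  have h : (𝓕 (x - y) : L2) = 𝓕 x - 𝓕 y := (Lp.fourierTransformₗᵢ ℝ ℂ).map_sub x y
  have h1 := quasiMeasurePreserving_div_two_pi.ae (Lp.coeFn_sub (𝓕 x : L2) (𝓕 y))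
  filter_upwards [h1] with ω hω
  simpa [angularFourier, h] using hω

theorem eq_of_angularFourier_ae_eq {x y : L2}
    (h : angularFourier x =ᵐ[volume] angularFourier y) : x = y := by
  have h1 : (𝓕 x : L2) = 𝓕 y := by
    refine Lp.ext ?_
    filter_upwards [(quasiMeasurePreserving_mul_left Real.two_pi_pos.ne').ae h] with ξ hξ
    rwa [angularFourier_two_pi_mul, angularFourier_two_pi_mul] at hξ
  exact (Lp.fourierTransformₗᵢ ℝ ℂ).injective h1

/-- Every square integrable function is the transform of an element of `L₂`. -/
theorem exists_angularFourier_eq {V : ℝ → ℂ} (hV : MemLp V 2) :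
    ∃ u : L2, angularFourier u =ᵐ[volume] V := by
  have hV' : MemLp (fun ξ => V (2 * Real.pi * ξ)) 2 := by
    have hmeas := hV.1.comp_quasiMeasurePreserving
      (quasiMeasurePreserving_mul_left Real.two_pi_pos.ne')
    have h := (memLp_two_iff_integrable_sq_norm hV.1).1 hV
    exact (memLp_two_iff_integrable_sq_norm hmeas).2 (h.comp_mul_left' Real.two_pi_pos.ne')
  refine ⟨𝓕⁻ (hV'.toLp _ : L2), ?_⟩
  have h1 : (𝓕 (𝓕⁻ (hV'.toLp _ : L2)) : L2) = hV'.toLp _ :=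
    FourierTransform.fourier_fourierInv_eq _
  filter_upwards [quasiMeasurePreserving_div_two_pi.ae hV'.coeFn_toLp] with ω hω
  rw [angularFourier, h1, hω, mul_div_cancel₀ _ Real.two_pi_pos.ne']

/-- Plancherel's formula in the angular frequency. -/
theorem norm_sq_eq_integral_angularFourier (x : L2) :
    ‖x‖ ^ 2 = (2 * Real.pi)⁻¹ * ∫ ω, ‖angularFourier x ω‖ ^ 2 := by
  have h1 : ‖x‖ ^ 2 = ∫ ξ, ‖(𝓕 x : L2) ξ‖ ^ 2 := by
    rw [← Lp.norm_fourier_eq, ← inner_self_eq_norm_sq (𝕜 := ℂ), L2.inner_def]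
    simp only [inner_self_eq_norm_sq_to_K]
    rw [← RCLike.ofReal_re (K := ℂ) (∫ ξ, ‖(𝓕 x : L2) ξ‖ ^ 2), ← integral_ofReal]
    simp
  have h2 := Measure.integral_comp_div (fun ξ => ‖(𝓕 x : L2) ξ‖ ^ 2) (2 * Real.pi)
  rw [abs_of_pos Real.two_pi_pos] at h2
  simp only [angularFourier]
  rw [h2, h1, smul_eq_mul, inv_mul_cancel_left₀ Real.two_pi_pos.ne']

/-- Fourier inversion in the angular frequency. -/
theorem isContRep_inverse (x : L2) (h : Integrable (angularFourier x)) :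
    IsContRep x fun t =>
      (2 * Real.pi : ℂ)⁻¹ * ∫ ω : ℝ, Complex.exp (ω * t * Complex.I) * angularFourier x ω := by
  have hX : Integrable ((𝓕 x : L2) : ℝ → ℂ) := by
    have := h.comp_mul_left' Real.two_pi_pos.ne'
    simpa only [angularFourier_two_pi_mul] using this
  have heq : (fun t : ℝ => (2 * Real.pi : ℂ)⁻¹ *
      ∫ ω : ℝ, Complex.exp (ω * t * Complex.I) * angularFourier x ω) =
      𝓕⁻ ((𝓕 x : L2) : ℝ → ℂ) := by
    funext t
    have h1 := Measure.integral_comp_mul_left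
      (fun ω : ℝ => Complex.exp (ω * t * Complex.I) * angularFourier x ω) (2 * Real.pi)
    rw [abs_of_pos (inv_pos.2 Real.two_pi_pos), Complex.real_smul] at h1
    push_cast at h1
    rw [← h1, Real.fourierInv_eq']
    refine integral_congr_ae (.of_forall fun ξ => ?_)
    simp only [angularFourier_two_pi_mul, smul_eq_mul, RCLike.inner_apply, conj_trivial]
    congr 2
    push_cast
    ring
  rw [heq]
  refine ⟨continuous_fourierInvIntegral hX, ?_⟩
  have h1 : (𝓕⁻ (𝓕 x : L2) : L2) = x := FourierTransform.fourierInv_fourier_eq x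
  have h2 := fourierInv_ae_eq_fourierInvIntegral (𝓕 x : L2) hX
  rwa [h1] at h2

theorem IsContRep.sub {x y : L2} {f g : ℝ → ℂ} (hf : IsContRep x f) (hg : IsContRep y g) :
    IsContRep (x - y) fun t => f t - g t := by
  refine ⟨hf.1.sub hg.1, ?_⟩
  filter_upwards [Lp.coeFn_sub x y, hf.2, hg.2] with t h h1 h2
  rw [h, Pi.sub_apply, h1, h2]

theorem IsContRep.unique {x : L2} {f g : ℝ → ℂ} (hf : IsContRep x f) (hg : IsContRep x g) :
    f = g :=
  (hf.1.ae_eq_iff_eq volume hg.1).1 (hf.2.symm.trans hg.2)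

/-- A band-limited function that vanishes at all sampling points `τ k`, `k ≤ s`, of an oversampled
grid is zero: its values at the sampling points are the Fourier coefficients of its transform, which
vanishes on an arc of the circle of length `2π/τ`. -/
theorem eq_zero_of_samples {Ω τ : ℝ} (hΩ : 0 < Ω) (hτ : 0 < τ) (hτΩ : τ < Real.pi / Ω) {x : L2}
    (hx : SpectrumVanishesOn x (Icc (-Ω) Ω)ᶜ) {f : ℝ → ℂ} (hf : IsContRep x f) {s : ℤ}
    (hs : ∀ k : ℤ, k ≤ s → f (τ * k) = 0) : x = 0 := by
  have hτΩ' : τ * Ω < Real.pi := (lt_div_iff₀ hΩ).1 hτΩ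
  set W : ℝ → ℂ := (Icc (-Ω) Ω).indicator (angularFourier x) with hW
  have hWx : W =ᵐ[volume] angularFourier x := by
    filter_upwards [hx] with ω hω
    by_cases h : ω ∈ Icc (-Ω) Ω
    · simp [hW, h]
    · rw [hω h, hW, indicator_of_notMem h]
  have hWint : Integrable W := by
    refine IntegrableOn.integrable_indicator ?_ measurableSet_Icc
    exact ((memLp_angularFourier x).locallyIntegrable one_le_two).integrableOn_isCompact
      isCompact_Icc
  have hinv := isContRep_inverse x (hWint.congr hWx)
  let φ : ℝ → Circle := fun ω => Circle.exp (-(τ * ω))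
  have hφ : Continuous φ := by fun_prop
  have hinj : InjOn φ (Icc (-Ω) Ω) := by
    have harg : ∀ ω ∈ Icc (-Ω) Ω, Complex.arg (φ ω) = -(τ * ω) := fun ω hω =>
      Circle.arg_exp (by nlinarith [hω.1, hω.2]) (by nlinarith [hω.1, hω.2])
    intro ω hω η hη h
    have := congrArg (fun z : Circle => Complex.arg z) h
    simp only [harg ω hω, harg η hη] at this
    exact mul_left_cancel₀ hτ.ne' (neg_injective this)
  -- The arc of the circle near `-1` is not reached from `[-Ω, Ω]`, as `τ Ω < π`.
  have hmom := moments_eq_zero_of_gap hφ hWint (Circle.exp Real.pi) (x₀ := -Real.cos (τ * Ω))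
    (by
      have := Real.cos_lt_cos_of_nonneg_of_le_pi (by positivity) le_rfl hτΩ'
      rw [Real.cos_pi] at this
      linarith)
    (N := -s) (.of_forall fun ω hω => by
      by_contra hne
      have hmem : ω ∈ Icc (-Ω) Ω := by
        by_contra h
        exact hne (indicator_of_notMem h _)
      have hre : ((Circle.exp Real.pi * φ ω : Circle) : ℂ).re = -Real.cos (τ * ω) := by
        rw [← Circle.exp_add, Circle.coe_exp, Complex.exp_ofReal_mul_I_re, ← sub_eq_add_neg,
          Real.cos_pi_sub]
      rw [hre] at hω
      have h1 : |τ * ω| ≤ τ * Ω := by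
        rw [abs_mul, abs_of_pos hτ]
        gcongr
        exact abs_le.2 hmem
      have h2 := Real.cos_le_cos_of_nonneg_of_le_pi (abs_nonneg _) hτΩ'.le h1
      rw [Real.cos_abs] at h2
      linarith)
    (by
      intro k hk
      have h1 : f (τ * (-k : ℤ)) = 0 := hs (-k) (by omega)
      rw [hf.unique hinv] at h1
      have h2 := (mul_eq_zero.1 h1).resolve_left (by simp [Real.pi_ne_zero])
      rw [← h2]
      refine integral_congr_ae ?_
      filter_upwards [hWx] with ω hω
      rw [hω, mul_comm, ← Circle.coe_zpow, ← Circle.exp_intCast_mul, Circle.coe_exp]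
      congr 2
      push_cast
      ring)
  have hW0 := ae_eq_zero_of_moments_eq_zero hφ hWint isClosed_Icc hinj
    (fun ω hω => indicator_of_notMem hω _) hmom
  have hx0 : angularFourier x =ᵐ[volume] 0 := hWx.symm.trans hW0
  have h0 := norm_sq_eq_integral_angularFourier x
  rw [integral_eq_zero_of_ae (by filter_upwards [hx0] with ω hω; simp [hω]), mul_zero] at h0
  simpa using h0

end Branching

/-! ### Construction of the approximating process -/

namespace Branching

/-- The bounds of a multiplier and of its inverse on `D`, as real numbers. -/
theorem IsMultiplier.exists_bound {D : Set ℝ} {F : L2 → L2} (hD : MeasurableSet D)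
    (hF : IsMultiplier D F) :
    ∃ (H : ℝ → ℂ) (C : ℝ), 0 ≤ C ∧ AEStronglyMeasurable H volume ∧ (∀ᵐ ω, ‖H ω‖ ≤ C) ∧
      (∀ᵐ ω, ω ∈ D → H ω ≠ 0 ∧ ‖(H ω)⁻¹‖ ≤ C) ∧
      ∀ x : L2, angularFourier (F x) =ᵐ[volume] fun ω => H ω * angularFourier x ω := by
  obtain ⟨H, hH, hinv, hmul⟩ := hF
  set e := essSup (fun ω => ‖H ω‖ₑ⁻¹) (volume.restrict D) with he
  refine ⟨H, max (eLpNorm H ∞ volume).toReal e.toReal, le_max_of_le_left ENNReal.toReal_nonneg,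
    hH.1, ?_, ?_, hmul⟩
  · filter_upwards [ae_le_eLpNormEssSup (f := H) (μ := volume)] with ω hω
    refine le_max_of_le_left ?_
    rw [← toReal_enorm]
    rw [eLpNorm_exponent_top]
    exact ENNReal.toReal_mono (by simpa using hH.2.ne) hω
  · filter_upwards [(ae_restrict_iff' hD).1
      (ENNReal.ae_le_essSup (μ := volume.restrict D) fun ω => ‖H ω‖ₑ⁻¹)] with ω hω hωD
    have h1 : ‖H ω‖ₑ⁻¹ ≤ e := hω hωD
    have hne : H ω ≠ 0 := by
      intro h0
      rw [h0, enorm_zero, ENNReal.inv_zero, top_le_iff] at h1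
      exact hinv.ne h1
    refine ⟨hne, le_max_of_le_right ?_⟩
    rw [norm_inv, ← toReal_enorm, ← ENNReal.toReal_inv]
    exact ENNReal.toReal_mono hinv.ne h1

theorem IsMultiplier.map_sub {D : Set ℝ} {F : L2 → L2} (hF : IsMultiplier D F) (x y : L2) :
    F (x - y) = F x - F y := by
  obtain ⟨H, -, -, hmul⟩ := hF
  refine eq_of_angularFourier_ae_eq ?_
  filter_upwards [hmul (x - y), hmul x, hmul y, angularFourier_sub x y,
    angularFourier_sub (F x) (F y)] with ω h1 h2 h3 h4 h5
  rw [h1, h4, h5, h2, h3, mul_sub]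

theorem isMultiplier_id (D : Set ℝ) : IsMultiplier D fun x => x := by
  refine ⟨fun _ => 1, memLp_top_const 1, ?_, fun x => by simp⟩
  refine lt_of_le_of_lt (essSup_le_of_ae_le 1 (.of_forall fun ω => ?_)) ENNReal.one_lt_top
  simp

theorem exists_Ioo_subset_of_volume_pos {D : Set ℝ} (hD : IsOpen D) {Ω : ℝ}
    (hpos : 0 < volume (D ∩ Icc (-Ω) Ω)) :
    ∃ p r : ℝ, 0 < r ∧ Ioo p (p + r) ⊆ D ∩ Ioo (-Ω) Ω := by
  have hne : (D ∩ Ioo (-Ω) Ω).Nonempty := by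
    by_contra hcon
    rw [not_nonempty_iff_eq_empty] at hcon
    have hsub : D ∩ Icc (-Ω) Ω ⊆ {-Ω, Ω} := by
      rintro ω ⟨hω, h1, h2⟩
      by_contra hmem
      simp only [mem_insert_iff, mem_singleton_iff, not_or] at hmem
      have : ω ∈ D ∩ Ioo (-Ω) Ω :=
        ⟨hω, lt_of_le_of_ne h1 (Ne.symm hmem.1), lt_of_le_of_ne h2 hmem.2⟩
      rw [hcon] at this
      exact this
    have h0 : volume (D ∩ Icc (-Ω) Ω) = 0 :=
      measure_mono_null hsub (Set.Finite.measure_zero (by simp) _)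
    exact hpos.ne' h0
  obtain ⟨p, hp⟩ := hne
  obtain ⟨r, hr, hball⟩ := Metric.isOpen_iff.1 (hD.inter isOpen_Ioo) p hp
  refine ⟨p, r, hr, fun t ht => hball ?_⟩
  rw [Metric.mem_ball, Real.dist_eq, abs_lt]
  constructor <;> linarith [ht.1, ht.2]

theorem exists_setIntegral_Ioo_lt {g : ℝ → ℝ} (hg : Integrable g) (p : ℝ) {r κ : ℝ} (hr : 0 < r)
    (hκ : 0 < κ) : ∃ h, 0 < h ∧ h ≤ r ∧ ∫ ω in Ioo p (p + h), g ω < κ := by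
  have hc : Continuous fun b : ℝ => ∫ ω in p..b, g ω :=
    intervalIntegral.continuous_primitive (fun _ _ => hg.intervalIntegrable) p
  have h0 : ∀ᶠ b in nhds p, ∫ ω in p..b, g ω < κ :=
    hc.continuousAt.eventually (gt_mem_nhds (by simpa using hκ))
  obtain ⟨δ, hδ, hball⟩ := Metric.eventually_nhds_iff.1 h0
  refine ⟨min r (δ / 2), by positivity, min_le_left _ _, ?_⟩
  have hpos : 0 < min r (δ / 2) := by positivity
  have h1 := hball (y := p + min r (δ / 2)) (by
    rw [Real.dist_eq, add_sub_cancel_left, abs_of_pos hpos]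
    exact (min_le_right _ _).trans_lt (by linarith))
  rwa [intervalIntegral.integral_of_le (by linarith), integral_Ioc_eq_integral_Ioo] at h1

/-- The `j`-th of `m` equal subintervals of `(p, p + h)`. -/
def subinterval (m : ℕ) (p h : ℝ) (j : ℕ) : Set ℝ :=
  Ioo (p + h * j / m) (p + h * (j + 1) / m)

theorem subinterval_subset {m : ℕ} {p h : ℝ} (hh : 0 < h) (j : Fin m) :
    subinterval m p h j ⊆ Ioo p (p + h) := by
  have hm : (0 : ℝ) < m := by exact_mod_cast j.pos
  refine Ioo_subset_Ioo (by simp only [le_add_iff_nonneg_right]; positivity) ?_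
  have : ((j : ℕ) : ℝ) + 1 ≤ m := by exact_mod_cast j.2
  rw [add_le_add_iff_left, div_le_iff₀ hm]
  gcongr

theorem disjoint_subinterval {m : ℕ} {p h : ℝ} (hh : 0 < h) {i j : Fin m} (hij : i ≠ j) :
    Disjoint (subinterval m p h i) (subinterval m p h j) := by
  have hm : (0 : ℝ) < m := by exact_mod_cast j.pos
  have key : ∀ i j : ℕ, i < j → ∀ ω ∈ subinterval m p h i, ω ∉ subinterval m p h j := by
    intro i j hij ω hi hj
    have h1 : (i : ℝ) + 1 ≤ j := by exact_mod_cast hij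
    have h2 : h * (i + 1) / m ≤ h * j / m := by gcongr
    linarith [hi.2, hj.1]
  refine Set.disjoint_left.2 fun ω hi hj => ?_
  rcases lt_or_gt_of_ne (Fin.val_ne_of_ne hij) with h | h
  · exact key _ _ h ω hi hj
  · exact key _ _ h ω hj hi

/-- A single small correction `u` of the root, band-limited to `[-Ω, Ω]`, whose images under the
multipliers `L d` remove a spectrum gap from each of the processes `x d`: on the gap of `x d`, the
transform of `u` is `X_d / H_d`, and the gaps are disjoint and short. -/
theorem exists_correction {m : ℕ} {L : Fin m → L2 → L2} {D : Set ℝ} (hD : IsOpen D) {Ω : ℝ}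
    (hpos : 0 < volume (D ∩ Icc (-Ω) Ω)) (hL : ∀ d, IsMultiplier D (L d)) (x : Fin m → L2)
    (hx : ∀ d, Integrable (angularFourier (x d))) {ε : ℝ} (hε : 0 < ε) :
    ∃ (u : L2) (c e : Fin m → ℝ), (∀ d, c d < e d) ∧ SpectrumVanishesOn u (Icc (-Ω) Ω)ᶜ ∧
      ∀ d, Integrable (angularFourier (L d u)) ∧
        SpectrumVanishesOn (x d - L d u) (Ioo (c d) (e d)) ∧
        ‖L d u‖ ≤ ε ∧ ∫ ω, ‖angularFourier (L d u) ω‖ ≤ ε := by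
  obtain ⟨p, r, hr, hsub⟩ := exists_Ioo_subset_of_volume_pos hD hpos
  choose H B hB0 hHm hHB hHinv hmul using fun d => (hL d).exists_bound hD.measurableSet
  obtain ⟨C, hC0, hBC⟩ : ∃ C : ℝ, 0 ≤ C ∧ ∀ d, B d ≤ C :=
    ⟨∑ d, B d, Finset.sum_nonneg fun d _ => hB0 d,
      fun d => Finset.single_le_sum (fun d _ => hB0 d) (Finset.mem_univ d)⟩
  set g : ℝ → ℝ := fun ω => ∑ d, ‖angularFourier (x d) ω‖ with hg
  have hg0 : ∀ ω, 0 ≤ g ω := fun ω => Finset.sum_nonneg fun d _ => norm_nonneg _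
  have hgi : Integrable g := integrable_finsetSum _ fun d _ => (hx d).norm
  have hg2 : MemLp g 2 := memLp_finsetSum _ fun d _ => (memLp_angularFourier (x d)).norm
  have hgsq : Integrable fun ω => g ω ^ 2 := by
    have := (memLp_two_iff_integrable_sq_norm hg2.1).1 hg2
    simpa using this
  -- `C ^ 2 * κ ≤ ε` bounds the `L₁` norms of the transforms, `C ^ 4 * κ ≤ ε ^ 2` the squares of the
  -- `L₂` norms.
  set κ : ℝ := min (ε / (C ^ 2 + 1)) (ε ^ 2 / (C ^ 4 + 1)) with hκ
  have hκpos : 0 < κ := by positivity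
  obtain ⟨h, hh, hhr, hsmall⟩ := exists_setIntegral_Ioo_lt (hgi.add hgsq) p hr hκpos
  set J : Set ℝ := Ioo p (p + h) with hJ
  have hJsub : J ⊆ D ∩ Ioo (-Ω) Ω := (Ioo_subset_Ioo_right (by linarith)).trans hsub
  have hgJ0 : 0 ≤ ∫ ω in J, g ω := integral_nonneg hg0
  have hgJsq0 : 0 ≤ ∫ ω in J, g ω ^ 2 := integral_nonneg fun ω => sq_nonneg _
  have hsum : (∫ ω in J, g ω) + ∫ ω in J, g ω ^ 2 < κ := by
    rw [← integral_add hgi.integrableOn hgsq.integrableOn]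
    exact hsmall
  have hgJ : ∫ ω in J, g ω ≤ κ := by linarith
  have hgJsq : ∫ ω in J, g ω ^ 2 ≤ κ := by linarith
  let G : Fin m → Set ℝ := fun d => subinterval m p h d
  have hGJ : ∀ d, G d ⊆ J := subinterval_subset hh
  set U : ℝ → ℂ := fun ω =>
    ∑ d, (G d).indicator (fun ω => (H d ω)⁻¹ * angularFourier (x d) ω) ω with hU
  have hUm : AEStronglyMeasurable U volume := by
    refine Finset.aestronglyMeasurable_fun_sum _ fun d _ => ?_
    exact ((hHm d).aemeasurable.inv.aestronglyMeasurable.mul (hx d).1).indicator measurableSet_Ioo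
  have hUG : ∀ d, ∀ ω ∈ G d, U ω = (H d ω)⁻¹ * angularFourier (x d) ω := by
    intro d ω hω
    rw [hU]
    refine (Finset.sum_eq_single d (fun j _ hj => ?_) (by simp)).trans (indicator_of_mem hω _)
    exact indicator_of_notMem (fun hωj => Set.disjoint_left.1 (disjoint_subinterval hh hj) hωj hω) _
  have hU0 : ∀ ω, ω ∉ J → U ω = 0 := by
    intro ω hω
    exact Finset.sum_eq_zero fun d _ => indicator_of_notMem (fun h => hω (hGJ d h)) _
  have hinv : ∀ᵐ ω, ∀ d, ω ∈ D → H d ω ≠ 0 ∧ ‖(H d ω)⁻¹‖ ≤ B d := ae_all_iff.2 hHinv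
  have hUle : ∀ᵐ ω, ‖U ω‖ ≤ C * J.indicator g ω := by
    filter_upwards [hinv] with ω hω
    by_cases hωJ : ω ∈ J
    · rw [indicator_of_mem hωJ, hg, Finset.mul_sum]
      refine (norm_sum_le _ _).trans (Finset.sum_le_sum fun d _ => ?_)
      refine (norm_indicator_le_norm_self _ _).trans ?_
      rw [norm_mul]
      gcongr
      exact (hω d (hJsub hωJ).1).2.trans (hBC d)
    · rw [hU0 ω hωJ, indicator_of_notMem hωJ]
      simp
  have hJg2 : MemLp (J.indicator g) 2 := hg2.indicator measurableSet_Ioo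
  have hUmem : MemLp U 2 := by
    refine (hJg2.const_mul C).mono hUm ?_
    filter_upwards [hUle] with ω hω
    exact hω.trans (le_abs_self _)
  obtain ⟨u, hu⟩ := exists_angularFourier_eq hUmem
  have hLu : ∀ d, ∀ᵐ ω, angularFourier (L d u) ω = H d ω * U ω := by
    intro d
    filter_upwards [hmul d u, hu] with ω h1 h2
    rw [h1, h2]
  have hVle : ∀ d, ∀ᵐ ω, ‖angularFourier (L d u) ω‖ ≤ C ^ 2 * J.indicator g ω := by
    intro d
    filter_upwards [hLu d, hUle, hHB d] with ω h1 h2 h3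
    rw [h1, norm_mul, sq, mul_assoc]
    exact mul_le_mul (h3.trans (hBC d)) h2 (norm_nonneg _) hC0
  have hJgi : Integrable (J.indicator g) := hgi.indicator measurableSet_Ioo
  refine ⟨u, fun d => p + h * (d : ℕ) / m, fun d => p + h * ((d : ℕ) + 1) / m, fun d => ?_, ?_,
    fun d => ⟨?_, ?_, ?_, ?_⟩⟩
  · have hm : (0 : ℝ) < m := by exact_mod_cast d.pos
    dsimp only
    gcongr
    linarith
  · filter_upwards [hu] with ω hω hωc
    rw [hω]
    exact hU0 ω fun hJ' => hωc (Ioo_subset_Icc_self (hJsub hJ').2)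
  · exact (hJgi.const_mul _).mono' (memLp_angularFourier _).1 (hVle d)
  · filter_upwards [angularFourier_sub (x d) (L d u), hLu d, hinv] with ω h1 h2 h3 hωG
    rw [h1, h2, hUG d ω hωG, mul_inv_cancel_left₀ (h3 d (hJsub (hGJ d hωG)).1).1, sub_self]
  · refine abs_le_of_sq_le_sq' ?_ hε.le |>.2
    have h1 : ∫ ω, ‖angularFourier (L d u) ω‖ ^ 2 ≤ C ^ 4 * ∫ ω in J, g ω ^ 2 := by
      rw [← integral_indicator (show MeasurableSet J from measurableSet_Ioo), ← integral_const_mul]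
      refine integral_mono_of_nonneg (.of_forall fun ω => sq_nonneg _)
        ((hgsq.indicator measurableSet_Ioo).const_mul _) ?_
      filter_upwards [hVle d] with ω hω
      refine (pow_le_pow_left₀ (norm_nonneg _) hω 2).trans (le_of_eq ?_)
      by_cases hωJ : ω ∈ J
      · simp only [indicator_of_mem hωJ]; ring
      · simp [indicator_of_notMem hωJ]
    have h2 : C ^ 4 * ∫ ω in J, g ω ^ 2 ≤ ε ^ 2 := by
      have h3 : ∫ ω in J, g ω ^ 2 ≤ ε ^ 2 / (C ^ 4 + 1) := hgJsq.trans (min_le_right _ _)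
      rw [le_div_iff₀ (by positivity)] at h3
      nlinarith
    have h4 : 0 ≤ ∫ ω, ‖angularFourier (L d u) ω‖ ^ 2 := integral_nonneg fun ω => sq_nonneg _
    rw [norm_sq_eq_integral_angularFourier]
    refine (mul_le_of_le_one_left h4 (inv_le_one_of_one_le₀ ?_)).trans (h1.trans h2)
    linarith [Real.pi_gt_three]
  · have h1 : ∫ ω, ‖angularFourier (L d u) ω‖ ≤ C ^ 2 * ∫ ω in J, g ω := by
      rw [← integral_indicator (show MeasurableSet J from measurableSet_Ioo), ← integral_const_mul]
      exact integral_mono_of_nonneg (.of_forall fun ω => norm_nonneg _) (hJgi.const_mul _) (hVle d)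
    have h3 : ∫ ω in J, g ω ≤ ε / (C ^ 2 + 1) := hgJ.trans (min_le_left _ _)
    rw [le_div_iff₀ (by positivity)] at h3
    nlinarith

/-- In a grouped structure, the branches carry multipliers `L d` that are compatible with the
transformations along all edges. A branch reached from a group `M p` carries `F p`; a branch of
`M p` that is reached from no group carries `F p` too. A branch may lie in `M p` and be reached from
another group `M q`; then it has no outgoing edge, and `F q` prevails. -/
theorem IsGrouped.exists_multipliers {m : ℕ} [NeZero m] {T : BranchStructure m} {D : Set ℝ} {n : ℕ}
    {M : Fin n → Set (Fin m)} {F : Fin n → L2 → L2} (hT : IsGrouped T D M F)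
    (hreach : ∀ d : Fin m, d ≠ 0 → Reaches T 0 d) :
    ∃ L : Fin m → L2 → L2, (∀ u, L 0 u = u) ∧ (∀ d, IsMultiplier D (L d)) ∧
      ∀ d k, (d, k) ∈ T.Γ → ∀ a u, T.h d k (a - L d u) = T.h d k a - L k u := by
  have hgroup : ∀ d : Fin m, d ≠ 0 → ∃ q, d ∈ descendants T (M q) ∨
      ((∀ p, d ∉ descendants T (M p)) ∧ d ∈ M q) := by
    intro d hd
    obtain ⟨c, -, hc⟩ := Relation.TransGen.tail'_iff.1 (hreach d hd).2
    by_cases h : ∃ q, d ∈ descendants T (M q)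
    · obtain ⟨q, hq⟩ := h
      exact ⟨q, Or.inl hq⟩
    · push Not at h
      rcases hT.covers c d hc with ⟨q, hq⟩ | ⟨q, hq⟩
      · exact ⟨q, Or.inr ⟨h, hq⟩⟩
      · exact absurd hq (h q)
  have hex : ∀ d : Fin m, ∃ L : L2 → L2, (d = 0 → ∀ u, L u = u) ∧ IsMultiplier D L ∧
      (∀ q, d ∈ descendants T (M q) → ∀ u, L u = F q u) ∧
      (∀ q, d ∈ M q → (∀ p, d ∉ descendants T (M p)) → ∀ u, L u = F q u) := by
    intro d
    have huniqA : ∀ p q, d ∈ descendants T (M p) → d ∈ descendants T (M q) → p = q := by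
      intro p q hp hq
      by_contra hne
      exact Set.disjoint_left.1 (hT.disjoint_A p q hne) hp hq
    have huniqM : ∀ p q, d ∈ M p → d ∈ M q → p = q := by
      intro p q hp hq
      by_contra hne
      exact Set.disjoint_left.1 (hT.disjoint_M p q hne) hp hq
    by_cases hd : d = 0
    · refine ⟨fun u => u, fun _ _ => rfl, isMultiplier_id D, fun q hq u => ?_, fun q hq => ?_⟩
      · exact (hT.loop_root q (hd ▸ hq) u).symm
      · exact absurd (hd ▸ hq) (hT.root_notMem q)
    · obtain ⟨q, hq⟩ := hgroup d hd
      refine ⟨F q, fun h => absurd h hd, hT.multiplier q, fun p hp u => ?_, fun p hp hA u => ?_⟩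
      · rcases hq with hq | hq
        · rw [huniqA p q hp hq]
        · exact absurd hp (hq.1 p)
      · rcases hq with hq | hq
        · exact absurd hq (hA q)
        · rw [huniqM p q hp hq.2]
  choose L hL0 hLmul hLA hLM using hex
  refine ⟨L, hL0 0 rfl, hLmul, fun d k hdk a u => ?_⟩
  by_cases hd : d = 0
  · subst hd
    rw [hL0 0 rfl]
    by_cases hA : ∃ q, k ∈ descendants T (M q)
    · obtain ⟨q, hq⟩ := hA
      rw [hT.loop_branch q k hq hdk, hT.loop_branch q k hq hdk, hLA k q hq,
        (hT.multiplier q).map_sub]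
    · push Not at hA
      rcases hT.covers 0 k hdk with ⟨q, hq⟩ | ⟨q, hq⟩
      · rw [hT.transform q k hq hdk, hT.transform q k hq hdk, hLM k q hq hA,
          (hT.multiplier q).map_sub]
      · exact absurd hq (hA q)
  · rw [hT.identity d k hdk (Or.inl hd), hT.identity d k hdk (Or.inl hd)]
    obtain ⟨q, hq⟩ := hgroup d hd
    have hk : k ∈ descendants T (M q) := by
      rcases hq with hq | hq
      · exact hT.closed_A d k hdk q hq
      · exact ⟨d, hq.2, T.ne_of_mem d k hdk, Relation.TransGen.single hdk⟩
    have hLd : L d u = F q u := by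
      rcases hq with hq | hq
      · exact hLA d q hq u
      · exact hLM d q hq.2 hq.1 u
    rw [hLd, hLA k q hk]

/-- Equality on a half-line together with a common spectrum gap implies equality. -/
theorem eq_of_ae_eq_on_isInf {x y : L2} {B : Set ℝ} (hB : IsInf B)
    (h : ∀ᵐ t : ℝ, t ∈ B → (x : ℝ → ℂ) t = (y : ℝ → ℂ) t) {c d : ℝ} (hcd : c < d)
    (hx : SpectrumVanishesOn x (Ioo c d)) (hy : SpectrumVanishesOn y (Ioo c d)) : x = y := by
  have hgap : SpectrumVanishesOn (x - y) (Ioo c d) := by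
    filter_upwards [angularFourier_sub x y, hx, hy] with ω h1 h2 h3 hω
    rw [h1, h2 hω, h3 hω, sub_self]
  obtain ⟨-, a, ha | ha⟩ := hB
  · refine sub_eq_zero.1 (eq_zero_of_halfLine_of_gap (x - y) (Or.inl rfl) a ?_ hcd hgap)
    filter_upwards [h, Lp.coeFn_sub x y] with t h1 h2 ht
    rw [h2, Pi.sub_apply, h1 (ha (by simpa using ht)), sub_self]
  · refine sub_eq_zero.1 (eq_zero_of_halfLine_of_gap (x - y) (Or.inr rfl) a ?_ hcd hgap)
    filter_upwards [h, Lp.coeFn_sub x y] with t h1 h2 ht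
    rw [h2, Pi.sub_apply, h1 (ha (by simpa using ht)), sub_self]

end Branching

/-! ### Approximation by processes that are determined by samples of the root -/

theorem theorem4p1 (m : ℕ) [NeZero m] (T : Branching.BranchStructure m) (Ω τ : ℝ)
    (hΩ : 0 < Ω) (hτ : 0 < τ) (hτΩ : τ < Real.pi / Ω)
    (hI : ∀ d k, (d, k) ∈ T.Γ → Branching.IsInf (T.I d k))
    (hT : (Branching.IdentityTransforms T ∧ Branching.GraphConnected T) ∨
      ((∀ d : Fin m, d ≠ 0 → Branching.Reaches T 0 d) ∧
        ∃ (n : ℕ) (D : Set ℝ) (M : Fin n → Set (Fin m))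
          (F : Fin n → Branching.L2 → Branching.L2),
          Branching.IsGrouped T D M F ∧ 0 < MeasureTheory.volume (D \ (Set.Icc (-Ω) Ω)ᶜ)))
    (x : Fin m → Branching.L2) (hx : Branching.IsContBranched T x)
    (hx0 : Branching.SpectrumVanishesOn (x 0) (Set.Icc (-Ω) Ω)ᶜ)
    (ε : ℝ) (hε : 0 < ε) :
    ∃ (G : Fin m → Set ℝ) (y : Fin m → Branching.L2),
      (∀ d, Branching.IsAdm (G d)) ∧ G 0 = (Set.Icc (-Ω) Ω)ᶜ ∧
      Branching.IsBranchedWithGaps T G y ∧ Branching.IsContBranched T y ∧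
      (∀ d, ∃ f g : ℝ → ℂ, Branching.IsContRep (x d) f ∧ Branching.IsContRep (y d) g ∧
        ∀ t, ‖x d - y d‖ + ‖f t - g t‖ ≤ ε) ∧
      (∀ z : Fin m → Branching.L2, Branching.IsBranchedWithGaps T G z →
        (∀ d, Branching.SameSamples τ Set.univ (z d) (y d)) → z = y) ∧
      (∀ s : ℤ, ∀ z : Fin m → Branching.L2, Branching.IsBranchedWithGaps T G z →
        Branching.SameSamples τ (Set.Iic s) (z 0) (y 0) → z = y) := by
  open Branching in
  obtain ⟨D, L, hD, hpos, hL0, hLmul, hcompat⟩ : ∃ (D : Set ℝ) (L : Fin m → L2 → L2), IsOpen D ∧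
      0 < volume (D ∩ Icc (-Ω) Ω) ∧ (∀ u, L 0 u = u) ∧ (∀ d, IsMultiplier D (L d)) ∧
      ∀ d k, (d, k) ∈ T.Γ → ∀ a u, T.h d k (a - L d u) = T.h d k a - L k u := by
    rcases hT with ⟨hid, -⟩ | ⟨hreach, n, D, M, F, hgr, hpos⟩
    · refine ⟨univ, fun _ u => u, isOpen_univ, ?_, fun _ => rfl, fun _ => isMultiplier_id _,
        fun d k hdk a u => ?_⟩
      · simpa using hΩ
      · rw [hid d k hdk, hid d k hdk]
    · obtain ⟨L, h1, h2, h3⟩ := hgr.exists_multipliers hreach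
      exact ⟨D, L, hgr.isOpen_D, by rwa [sdiff_compl] at hpos, h1, h2, h3⟩
  -- Properties of branches that are inherited along edges pass from the root to all branches; for
  -- identity transforms they have to be inherited in both directions.
  have hprop : ∀ P : Fin m → Prop, P 0 → (∀ d k, (d, k) ∈ T.Γ → P d → P k) →
      (IdentityTransforms T → ∀ d k, (d, k) ∈ T.Γ → P k → P d) → ∀ d, P d := by
    intro P h0 hfwd hbwd d
    rcases hT with ⟨hid, hconn⟩ | ⟨hreach, -⟩
    · induction hconn 0 d with
      | refl => exact h0
      | tail _ hstep ih =>
        exact hstep.elim (fun h => hfwd _ _ h ih) (fun h => hbwd hid _ _ h ih)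
    · by_cases hd : d = 0
      · exact hd ▸ h0
      · have hchain : ∀ k, Relation.TransGen (fun a b => (a, b) ∈ T.Γ) 0 k → P k := by
          intro k hk
          induction hk with
          | single hstep => exact hfwd _ _ hstep h0
          | tail _ hstep ih => exact hfwd _ _ hstep ih
        exact hchain d (hreach d hd).2
  obtain ⟨u, c, e, hce, hu, hLu⟩ := exists_correction hD hpos hLmul x (fun d => (hx.2 d).2)
    (half_pos hε)
  set y : Fin m → L2 := fun d => x d - L d u with hy
  set G : Fin m → Set ℝ := fun d => if d = 0 then (Icc (-Ω) Ω)ᶜ else Ioo (c d) (e d) with hG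
  have hbranched : IsBranched T y := by
    intro d k hdk
    have h1 : T.h d k (y d) = T.h d k (x d) - L k u := hcompat d k hdk (x d) u
    filter_upwards [hx.1 d k hdk, Lp.coeFn_sub (x k) (L k u),
      Lp.coeFn_sub (T.h d k (x d)) (L k u)] with t h2 h3 h4 ht
    rw [h1, h3, h4, Pi.sub_apply, Pi.sub_apply, h2 ht]
  have hygaps : IsBranchedWithGaps T G y := by
    refine ⟨hbranched, fun d => ?_⟩
    by_cases hd : d = 0
    · subst hd
      simp only [hG, if_true, hy, hL0]
      filter_upwards [angularFourier_sub (x 0) u, hx0, hu] with ω h1 h2 h3 hω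
      rw [h1, h2 hω, h3 hω, sub_self]
    · simp only [hG, if_neg hd]
      exact (hLu d).2.1
  have hrep := fun d => isContRep_inverse (L d u) (hLu d).1
  have hgapIoo : ∀ d, ∃ a b : ℝ, a < b ∧ Ioo a b ⊆ G d := by
    intro d
    by_cases hd : d = 0
    · refine ⟨Ω, Ω + 1, by linarith, fun ω hω => ?_⟩
      simp only [hG, if_pos hd]
      exact fun h => not_lt.2 h.2 hω.1
    · exact ⟨c d, e d, hce d, by simp [hG, hd]⟩
  have huniq : ∀ s : ℤ, ∀ z : Fin m → L2, IsBranchedWithGaps T G z →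
      SameSamples τ (Iic s) (z 0) (y 0) → z = y := by
    intro s z hz hsamp
    have h0 : z 0 = y 0 := by
      obtain ⟨f, g, hf, hg, hfg⟩ := hsamp
      refine sub_eq_zero.1 (eq_zero_of_samples hΩ hτ hτΩ ?_ (hf.sub hg) (s := s)
        fun k hk => sub_eq_zero.2 (hfg k hk))
      have h1 := hz.2 0
      have h2 := hygaps.2 0
      simp only [hG, if_true] at h1 h2
      filter_upwards [angularFourier_sub (z 0) (y 0), h1, h2] with ω h3 h4 h5 hω
      rw [h3, h4 hω, h5 hω, sub_self]
    have hstep : ∀ d, ∀ B, IsInf B → (∀ᵐ t : ℝ, t ∈ B → (z d : ℝ → ℂ) t = (y d : ℝ → ℂ) t) →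
        z d = y d := by
      intro d B hB hae
      obtain ⟨a, b, hab, hsub⟩ := hgapIoo d
      refine eq_of_ae_eq_on_isInf hB hae hab ?_ ?_
      · filter_upwards [hz.2 d] with ω h hω using h (hsub hω)
      · filter_upwards [hygaps.2 d] with ω h hω using h (hsub hω)
    refine funext (hprop (fun d => z d = y d) h0 (fun d k hdk h => ?_) (fun hid d k hdk h => ?_))
    · refine hstep k _ (hI d k hdk) ?_
      filter_upwards [hz.1 d k hdk, hbranched d k hdk] with t h1 h2 ht
      rw [h1 ht, h2 ht, h]
    · refine hstep d _ (hI d k hdk) ?_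
      filter_upwards [hz.1 d k hdk, hbranched d k hdk] with t h1 h2 ht
      have h3 := h1 ht
      have h4 := h2 ht
      rw [hid d k hdk] at h3 h4
      rw [← h3, ← h4, h]
  refine ⟨G, y, fun d => ?_, by simp [hG], hygaps, ⟨hbranched, fun d => ⟨?_, ?_⟩⟩, fun d => ?_,
    fun z hz hs => ?_, huniq⟩
  · by_cases hd : d = 0
    · refine Or.inr ?_
      simp only [hG, if_pos hd]
      exact ⟨measurableSet_Icc.compl, Ω, Or.inl fun t ht h => not_lt.2 h.2 ht⟩
    · refine Or.inl ?_
      simp only [hG, if_neg hd]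
      refine ⟨measurableSet_Ioo, ?_, ?_⟩
      · simpa using hce d
      · simp
  · obtain ⟨f, hf⟩ := (hx.2 d).1
    exact ⟨_, hf.sub (hrep d)⟩
  · exact (((hx.2 d).2.sub (hLu d).1).congr (angularFourier_sub (x d) (L d u)).symm)
  · obtain ⟨f, hf⟩ := (hx.2 d).1
    refine ⟨f, _, hf, hf.sub (hrep d), fun t => ?_⟩
    have h1 : ‖x d - y d‖ ≤ ε / 2 := by
      simpa [hy] using (hLu d).2.2.1
    have h2 : ‖(2 * Real.pi : ℂ)⁻¹ *
        ∫ ω : ℝ, Complex.exp (ω * t * Complex.I) * angularFourier (L d u) ω‖ ≤ ε / 2 := by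
      have h3 : ‖∫ ω : ℝ, Complex.exp (ω * t * Complex.I) * angularFourier (L d u) ω‖ ≤ ε / 2 := by
        refine (norm_integral_le_integral_norm _).trans (le_of_eq_of_le ?_ (hLu d).2.2.2)
        refine integral_congr_ae (.of_forall fun ω => ?_)
        have : Complex.exp (ω * t * Complex.I) = Complex.exp (((ω * t : ℝ) : ℂ) * Complex.I) := by
          push_cast; rfl
        simp only [norm_mul, this, Complex.norm_exp_ofReal_mul_I, one_mul]
      rw [norm_mul]
      refine (mul_le_of_le_one_left (norm_nonneg _) ?_).trans h3
      rw [norm_inv, norm_mul, Complex.norm_real, Real.norm_of_nonneg Real.pi_pos.le]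
      refine inv_le_one_of_one_le₀ ?_
      simp
      linarith [Real.pi_gt_three]
    refine (add_le_add h1 ?_).trans (add_halves ε).le
    rwa [sub_sub_cancel]
  · obtain ⟨f, g, hf, hg, hfg⟩ := hs 0
    exact huniq 0 z hz ⟨f, g, hf, hg, fun k _ => hfg k (mem_univ k)⟩
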